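/- Let $\beta>1$, $s>0$ and $\eta_{\mathrm{stab}}>0$ be fixed, and let $K(u)=(1+u)^{-(2-1/\beta)}$ for $u\ge 0$. For a horizon $N>0$ consider the problem of minimising $$\mathcal F_N[t]=(1+t(N))^{-s}+\int_0^N K\bigl(t(N)-t(z)\bigr)\,t'(z)^2\,dz$$ over all absolutely continuous $t:[0,N]\to\mathbb R$ with $t(0)=0$ and $0\le t'(z)\le\eta_{\mathrm{stab}}$ for almost every $z\in[0,N]$. Let $t_*$ be a minimiser, $\eta^*=t_*'$ and $\mathcal E_N^*=\mathcal F_N[t_*]$. Below, $N\to\infty$; $f_N\asymp g_N$ means $c\,g_N\le f_N\le C\,g_N$ for all sufficiently large $N$; and the constants $c,C>0$, the threshold for $N$ and the rate at which $o_N(1)$ terms vanish depend only on $\beta,s,\eta_{\mathrm{stab}}$. 1. (Easy-task regime.) If $s\ge 1-\frac1\beta$, then $$\mathcal E_N^*\asymp N^{-\frac{s\beta}{s\beta+1}} .$$ If $s>1-\frac1\beta$, or if $s=1-\frac1\beta$ and $\eta_{\mathrm{stab}}\ge\frac12\bigl(1-\frac1\beta\bigr)$, then for all sufficiently large $N$ the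 optimal learning rate is a power decay: there are numbers $\eta_{\mathrm{peak}}$ and $\delta_N=o_N(1)$ (independent of $z$) with $$\eta^*(z)=\eta_{\mathrm{peak}}\Bigl(1+\delta_N-\frac zN\Bigr)^{2\beta-1}\quad(0\le z\le N),\qquad \eta_{\mathrm{peak}}\asymp N^{-\frac{1+s\beta-\beta}{1+s\beta}},$$ where $1+\delta_N-z/N\ge 0$ throughout. 2. (Hard-task regime.) If $s<1-\frac1\beta$, then $\mathcal E_N^*\asymp N^{-s}$, and for all sufficiently large $N$ the optimal learning rate has the warmup–stable–decay form: there are $N_1\in(0,N)$ and $\varepsilon_N=o_N(1)$ with $$\eta^*(z)=\begin{cases}\eta_{\mathrm{stab}}, & 0\le z\le N_1,\\[2pt] \eta_{\mathrm{stab}}\Bigl(1+\varepsilon_N\,\dfrac{z-N_1}{N-N_1}-\dfrac{z-N_1}{N-N_1}\Bigr)^{2\beta-1}, & N_1<z\le N,\end{cases}$$ where the base of the power is nonnegative, and the fraction of the decay phase satisfies $$r_N=\frac{N-N_1}{N}\asymp N^{-\frac{(1-1/\beta)-s}{2-1/\beta}}=o_N(1).$$ -/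

import Mathlib

open Filter Topology MeasureTheory Set

noncomputable section

/-- The forgetting kernel `K(u) = (1 + u)^{-(2 - 1/β)}`. -/
def forgettingKernel (β u : ℝ) : ℝ :=
  (1 + u) ^ (-(2 - 1 / β))

/-- The final-step loss of the intrinsic-time function `t` over the horizon `N`:
`(1 + t(N))^{-s} + ∫_0^N K(t(N) - t(z)) t'(z)^2 dz`. -/
def finalLoss (β s N : ℝ) (t : ℝ → ℝ) : ℝ :=
  (1 + t N) ^ (-s)
    + ∫ z in (0 : ℝ)..N, forgettingKernel β (t N - t z) * (deriv t z) ^ 2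

/-- Admissible intrinsic-time functions: absolutely continuous on `[0, N]`, starting from `0`,
with a learning rate `t'` between `0` and `ηstab` almost everywhere on `[0, N]`. -/
structure IsAdmissible (ηstab N : ℝ) (t : ℝ → ℝ) : Prop where
  absCont : AbsolutelyContinuousOnInterval t 0 N
  zero : t 0 = 0
  rate : ∀ᵐ z ∂(volume.restrict (Icc 0 N)), 0 ≤ deriv t z ∧ deriv t z ≤ ηstab

/-- `t` minimises the final-step loss among all admissible functions on `[0, N]`. -/
def IsOptimal (β s ηstab N : ℝ) (t : ℝ → ℝ) : Prop :=
  IsAdmissible ηstab N t ∧ IsMinOn (finalLoss β s N) {u | IsAdmissible ηstab N u} t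

end

/-! The proof is by calibration. Suppose a continuous price `m` and a constant λ satisfy `m u * v ≤
K(u) v² + λ` for all rates `v` in `[0, η]`. Put `u = t(N) - t(z)`, `v = t'(z)` and integrate: by the
chain rule the left side becomes `∫₀^T m` with `T = t(N)`, so the loss is at least `(1+T)^{-s} +
∫₀^T m - λN`. This bound depends on `T` alone and is least where `m` crosses the marginal gain
`s(1+T)^{-s-1}` from below. Equality holds along the feedback law `t' = φ(T - t)`, where φ is the
rate at which the price touches the cost. As φ is increasing, that law has a single trajectory
(`IsOptimal.eqOn_of_certificate`).

Write `K = a²` and `λ = σ²`. Without the cap, `m = 2σa` and `φ = σ/a`, so `(1+T-t)^{1/(2β)}` is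
affine in `z`: this is the power decay, and its horizon equation fixes σ. It meets the cap for large
`N` exactly under the hypotheses on the easy schedule; as a lower bound for the loss it needs no
cap.

With the cap, `φ = min(η, σ/a)` and `m = a²φ + σ²/φ` (`supporting_price`). The rate is η while `1 +
T - t` is at least a level `Y`, and then decays. The crossing condition expresses `Y` through `X = 1
+ T` (`switchLevel_spec`), with `Y ≍ X^{(s+1)/(2-1/β)}`; since `X ≍ N` and the decay lasts a time of
order `Y`, the decay fraction follows. -/

theorem forgettingKernel_nonneg (β : ℝ) {u : ℝ} (hu : 0 ≤ u) : 0 ≤ forgettingKernel β u :=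
  Real.rpow_nonneg (by linarith) _

theorem continuousOn_forgettingKernel (β : ℝ) : ContinuousOn (forgettingKernel β) (Ici 0) := by
  unfold forgettingKernel
  refine ContinuousOn.rpow_const (by fun_prop) fun u hu => Or.inl ?_
  have : (0 : ℝ) ≤ u := hu
  linarith

/-! ### Admissible curves: bounds, integrability, change of variables -/

namespace IsAdmissible

variable {η N : ℝ} {t : ℝ → ℝ}

theorem increment_mem (h : IsAdmissible η N t) {x y : ℝ} (hx : 0 ≤ x) (hxy : x ≤ y)
    (hy : y ≤ N) : t y - t x ∈ Icc 0 (η * (y - x)) := by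
  have hsub : uIcc x y ⊆ uIcc 0 N := by
    rw [uIcc_of_le hxy, uIcc_of_le (hx.trans (hxy.trans hy))]
    exact Icc_subset_Icc hx hy
  have hac := h.absCont.mono hsub
  have hrate : ∀ᵐ z ∂(volume.restrict (Icc x y)), 0 ≤ deriv t z ∧ deriv t z ≤ η :=
    ae_restrict_of_ae_restrict_of_subset (Icc_subset_Icc hx hy) h.rate
  rw [← hac.integral_deriv_eq_sub]
  constructor
  · exact intervalIntegral.integral_nonneg_of_ae_restrict hxy (hrate.mono fun z hz => hz.1)
  · have := intervalIntegral.integral_mono_ae_restrict hxy hac.intervalIntegrable_deriv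
      (intervalIntegrable_const (c := η)) (hrate.mono fun z hz => hz.2)
    simpa [mul_comm] using this

theorem remaining_mem (h : IsAdmissible η N t) {z : ℝ} (hz : z ∈ Icc 0 N) :
    t N - t z ∈ Icc 0 (t N) := by
  have h1 := (h.increment_mem hz.1 hz.2 le_rfl).1
  have h2 := (h.increment_mem le_rfl hz.1 hz.2).1
  rw [h.zero] at h2
  exact ⟨h1, by linarith⟩

theorem terminal_nonneg (h : IsAdmissible η N t) (hN : 0 ≤ N) : 0 ≤ t N := by
  have := (h.increment_mem le_rfl hN le_rfl).1
  rwa [h.zero, sub_zero] at this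

theorem terminal_le (h : IsAdmissible η N t) (hN : 0 ≤ N) : t N ≤ η * N := by
  have := (h.increment_mem le_rfl hN le_rfl).2
  rwa [h.zero, sub_zero, sub_zero] at this

theorem lipschitzOnWith (h : IsAdmissible η N t) : LipschitzOnWith η.toNNReal t (Icc 0 N) := by
  refine LipschitzOnWith.of_le_add_mul' _ fun x hx y hy => ?_
  rcases le_total x y with hxy | hxy
  · have h1 := h.increment_mem hx.1 hxy hy.2
    have h2 : η * (y - x) = η * dist x y := by rw [dist_comm, Real.dist_eq, abs_of_nonneg (by linarith)]
    linarith [h1.1, h1.2]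
  · have h1 := h.increment_mem hy.1 hxy hx.2
    rw [Real.dist_eq, abs_of_nonneg (by linarith)]
    linarith [h1.2]

theorem ae_hasDerivAt (h : IsAdmissible η N t) (hN : 0 ≤ N) :
    ∀ᵐ z ∂(volume.restrict (Icc 0 N)),
      z ∈ Icc 0 N ∧ HasDerivAt t (deriv t z) z ∧ deriv t z ∈ Icc 0 η := by
  have hd := h.absCont.ae_differentiableAt
  rw [uIcc_of_le hN] at hd
  filter_upwards [h.rate, ae_restrict_mem measurableSet_Icc, ae_restrict_of_ae hd] with z hz hm hdz
  exact ⟨hm, (hdz hm).hasDerivAt, hz⟩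

theorem continuousOn (h : IsAdmissible η N t) (hN : 0 ≤ N) : ContinuousOn t (Icc 0 N) := by
  simpa [uIcc_of_le hN] using h.absCont.continuousOn

theorem comp_remaining_continuousOn (h : IsAdmissible η N t) (hN : 0 ≤ N) {g : ℝ → ℝ}
    (hg : ContinuousOn g (Ici 0)) : ContinuousOn (fun z => g (t N - t z)) (uIcc 0 N) := by
  rw [uIcc_of_le hN]
  exact hg.comp (continuousOn_const.sub (h.continuousOn hN)) fun z hz => (h.remaining_mem hz).1

theorem intervalIntegrable_mul_deriv (h : IsAdmissible η N t) (hN : 0 ≤ N) {g : ℝ → ℝ}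
    (hg : ContinuousOn g (Ici 0)) :
    IntervalIntegrable (fun z => g (t N - t z) * deriv t z) volume 0 N :=
  h.absCont.intervalIntegrable_deriv.continuousOn_mul (h.comp_remaining_continuousOn hN hg)

theorem intervalIntegrable_sq_deriv (h : IsAdmissible η N t) (hN : 0 ≤ N) :
    IntervalIntegrable (fun z => deriv t z ^ 2) volume 0 N := by
  refine ((h.absCont.intervalIntegrable_deriv).const_mul η).mono_fun
    ((measurable_deriv t).pow_const 2).aestronglyMeasurable ?_
  rw [uIoc_of_le hN]
  filter_upwards [ae_restrict_of_ae_restrict_of_subset Ioc_subset_Icc_self h.rate] with z hz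
  rw [Real.norm_of_nonneg (by positivity),
    Real.norm_of_nonneg (mul_nonneg (hz.1.trans hz.2) hz.1), sq]
  exact mul_le_mul_of_nonneg_right hz.2 hz.1

theorem intervalIntegrable_loss (h : IsAdmissible η N t) (hN : 0 ≤ N) (β : ℝ) :
    IntervalIntegrable (fun z => forgettingKernel β (t N - t z) * deriv t z ^ 2) volume 0 N :=
  (h.intervalIntegrable_sq_deriv hN).continuousOn_mul
    (h.comp_remaining_continuousOn hN (continuousOn_forgettingKernel β))

/-- The primitive of `m` is C¹, hence Lipschitz on the compact range of `t N - t z`; its composite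
with the Lipschitz curve is absolutely continuous, and the fundamental theorem applies to it. -/
theorem integral_comp_remaining (h : IsAdmissible η N t) (hN : 0 ≤ N) {m : ℝ → ℝ}
    (hm : Continuous m) :
    ∫ z in (0 : ℝ)..N, m (t N - t z) * deriv t z = ∫ u in (0 : ℝ)..t N, m u := by
  set M : ℝ → ℝ := fun x => ∫ u in (0 : ℝ)..x, m u with hMdef
  have hM : ∀ x, HasDerivAt M (m x) x := fun x =>
    intervalIntegral.integral_hasDerivAt_right (hm.intervalIntegrable _ _)
      (hm.stronglyMeasurableAtFilter _ _) hm.continuousAt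
  have hM1 : ContDiff ℝ 1 M := by
    rw [contDiff_one_iff_deriv]
    refine ⟨fun x => (hM x).differentiableAt, ?_⟩
    rw [show deriv M = m from funext fun x => (hM x).deriv]
    exact hm
  obtain ⟨C, hC⟩ := hM1.contDiffOn.exists_lipschitzOnWith (s := Icc 0 (t N)) (by decide)
    (convex_Icc _ _) isCompact_Icc
  have hL : LipschitzOnWith η.toNNReal (fun z => t N - t z) (Icc 0 N) := by
    intro x hx y hy
    have := h.lipschitzOnWith hx hy
    rwa [edist_sub_left]
  have hac : AbsolutelyContinuousOnInterval (fun z => M (t N - t z)) 0 N := by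
    refine LipschitzOnWith.absolutelyContinuousOnInterval (K := C * η.toNNReal) ?_
    rw [uIcc_of_le hN]
    exact hC.comp hL fun z hz => h.remaining_mem hz
  have hint := hac.integral_deriv_eq_sub
  have hcongr : ∫ z in (0 : ℝ)..N, deriv (fun z => M (t N - t z)) z
      = ∫ z in (0 : ℝ)..N, -(m (t N - t z) * deriv t z) := by
    refine intervalIntegral.integral_congr_ae_restrict ?_
    rw [uIoc_of_le hN]
    filter_upwards [ae_restrict_of_ae_restrict_of_subset Ioc_subset_Icc_self
      (h.ae_hasDerivAt hN)] with z hz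
    have := (hM (t N - t z)).comp z (hz.2.1.const_sub (t N))
    rw [show (fun z => M (t N - t z)) = M ∘ fun z => t N - t z from rfl, this.deriv]
    ring
  rw [hcongr, intervalIntegral.integral_neg, h.zero] at hint
  simp only [sub_self, sub_zero] at hint
  have h0 : M 0 = 0 := by simp [hMdef]
  linarith

end IsAdmissible

/-! ### Admissibility of explicit differentiable curves -/

theorem hasDerivAt_of_hasDerivWithinAt_Icc {t : ℝ → ℝ} {N v z : ℝ} (hz : z ∈ Ioo 0 N)
    (h : HasDerivWithinAt t v (Icc 0 N) z) : HasDerivAt t v z :=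
  h.hasDerivAt (Icc_mem_nhds hz.1 hz.2)

/-- A one-sided derivative at an endpoint does not determine `deriv` there; the two endpoints form a
null set. -/
theorem ae_deriv_eq_of_hasDerivWithinAt {t v : ℝ → ℝ} {N : ℝ}
    (h : ∀ z ∈ Icc 0 N, HasDerivWithinAt t (v z) (Icc 0 N) z) :
    ∀ᵐ z ∂(volume.restrict (Icc 0 N)), z ∈ Icc 0 N ∧ deriv t z = v z := by
  rw [← Measure.restrict_congr_set Ioo_ae_eq_Icc]
  filter_upwards [ae_restrict_mem measurableSet_Ioo] with z hz
  have hz' := Ioo_subset_Icc_self hz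
  exact ⟨hz', (hasDerivAt_of_hasDerivWithinAt_Icc hz (h z hz')).deriv⟩

theorem isAdmissible_of_hasDerivWithinAt {t v : ℝ → ℝ} {η N : ℝ} (hN : 0 ≤ N) (h0 : t 0 = 0)
    (h : ∀ z ∈ Icc 0 N, HasDerivWithinAt t (v z) (Icc 0 N) z)
    (hv : ∀ z ∈ Icc 0 N, v z ∈ Icc 0 η) : IsAdmissible η N t where
  absCont := by
    have hL : LipschitzOnWith η.toNNReal t (Icc 0 N) := by
      refine Convex.lipschitzOnWith_of_nnnorm_hasDerivWithin_le (convex_Icc _ _) h fun z hz => ?_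
      rw [← NNReal.coe_le_coe, coe_nnnorm, Real.norm_of_nonneg (hv z hz).1]
      exact (hv z hz).2.trans (Real.le_coe_toNNReal _)
    rw [← uIcc_of_le hN] at hL
    exact hL.absolutelyContinuousOnInterval
  zero := h0
  rate := by
    filter_upwards [ae_deriv_eq_of_hasDerivWithinAt h] with z hz
    rw [hz.2]
    exact hv z hz.1

/-! ### Calibration: lower bound, equality case, uniqueness -/

section Certificate

variable {β s η lam N : ℝ} {m : ℝ → ℝ} {t : ℝ → ℝ}

/-- A pointwise lower bound on the running cost integrates to a lower bound on the loss. -/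
theorem IsAdmissible.certificate_le_finalLoss (h : IsAdmissible η N t) (hN : 0 ≤ N)
    (hm : Continuous m)
    (hle : ∀ u, 0 ≤ u → ∀ v ∈ Icc 0 η, m u * v ≤ forgettingKernel β u * v ^ 2 + lam) :
    (1 + t N) ^ (-s) + (∫ u in (0 : ℝ)..t N, m u) - lam * N ≤ finalLoss β s N t := by
  have hmono := intervalIntegral.integral_mono_ae_restrict hN
    (h.intervalIntegrable_mul_deriv hN hm.continuousOn)
    ((h.intervalIntegrable_loss hN β).add (intervalIntegrable_const (c := lam)))
    ((h.ae_hasDerivAt hN).mono fun z hz => hle _ (h.remaining_mem hz.1).1 _ hz.2.2)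
  rw [h.integral_comp_remaining hN hm, intervalIntegral.integral_add
    (h.intervalIntegrable_loss hN β) intervalIntegrable_const] at hmono
  simp only [intervalIntegral.integral_const, smul_eq_mul, sub_zero] at hmono
  unfold finalLoss
  linarith

theorem IsAdmissible.finalLoss_eq_certificate (h : IsAdmissible η N t) (hN : 0 ≤ N)
    (hm : Continuous m)
    (heq : ∀ᵐ z ∂(volume.restrict (Icc 0 N)),
      m (t N - t z) * deriv t z = forgettingKernel β (t N - t z) * deriv t z ^ 2 + lam) :
    finalLoss β s N t = (1 + t N) ^ (-s) + (∫ u in (0 : ℝ)..t N, m u) - lam * N := by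
  have hcongr : ∫ z in (0 : ℝ)..N, m (t N - t z) * deriv t z
      = ∫ z in (0 : ℝ)..N, (forgettingKernel β (t N - t z) * deriv t z ^ 2 + lam) := by
    refine intervalIntegral.integral_congr_ae_restrict ?_
    rw [uIoc_of_le hN]
    exact ae_restrict_of_ae_restrict_of_subset Ioc_subset_Icc_self heq
  rw [h.integral_comp_remaining hN hm, intervalIntegral.integral_add
    (h.intervalIntegrable_loss hN β) intervalIntegrable_const] at hcongr
  simp only [intervalIntegral.integral_const, smul_eq_mul, sub_zero] at hcongr
  unfold finalLoss
  linarith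

/-- The slack in the pointwise bound is nonnegative with integral at most zero, so it vanishes
almost everywhere. -/
theorem IsAdmissible.ae_eq_of_finalLoss_le_certificate (h : IsAdmissible η N t) (hN : 0 ≤ N)
    (hm : Continuous m)
    (hle : ∀ u, 0 ≤ u → ∀ v ∈ Icc 0 η, m u * v ≤ forgettingKernel β u * v ^ 2 + lam)
    (hF : finalLoss β s N t ≤ (1 + t N) ^ (-s) + (∫ u in (0 : ℝ)..t N, m u) - lam * N) :
    ∀ᵐ z ∂(volume.restrict (Icc 0 N)),
      m (t N - t z) * deriv t z = forgettingKernel β (t N - t z) * deriv t z ^ 2 + lam := by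
  have hi1 := h.intervalIntegrable_mul_deriv hN hm.continuousOn
  have hi2 := (h.intervalIntegrable_loss hN β).add (intervalIntegrable_const (c := lam))
  have hnonneg : 0 ≤ᵐ[volume.restrict (Ioc 0 N)] fun z =>
      (forgettingKernel β (t N - t z) * deriv t z ^ 2 + lam) - m (t N - t z) * deriv t z := by
    filter_upwards [ae_restrict_of_ae_restrict_of_subset Ioc_subset_Icc_self
      (h.ae_hasDerivAt hN)] with z hz
    have := hle _ (h.remaining_mem hz.1).1 _ hz.2.2
    simpa using this
  have hzero : ∫ z in (0 : ℝ)..N,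
      ((forgettingKernel β (t N - t z) * deriv t z ^ 2 + lam) - m (t N - t z) * deriv t z) = 0 := by
    refine le_antisymm ?_ ?_
    · rw [intervalIntegral.integral_sub hi2 hi1, h.integral_comp_remaining hN hm,
        intervalIntegral.integral_add (h.intervalIntegrable_loss hN β) intervalIntegrable_const]
      simp only [intervalIntegral.integral_const, smul_eq_mul, sub_zero]
      unfold finalLoss at hF
      linarith
    · rw [intervalIntegral.integral_of_le hN]
      exact integral_nonneg_of_ae hnonneg
  rw [intervalIntegral.integral_eq_zero_iff_of_le_of_nonneg_ae hN hnonneg (hi2.sub hi1)] at hzero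
  rw [← Measure.restrict_congr_set Ioc_ae_eq_Icc]
  filter_upwards [hzero] with z hz
  simp only [Pi.zero_apply] at hz
  linarith

theorem hasDerivAt_terminalBound (hm : Continuous m) {x : ℝ} (hx : 0 ≤ x) :
    HasDerivAt (fun x => (1 + x) ^ (-s) + ∫ u in (0 : ℝ)..x, m u)
      (-s * (1 + x) ^ (-s - 1) + m x) x := by
  refine HasDerivAt.add ?_ (intervalIntegral.integral_hasDerivAt_right
    (hm.intervalIntegrable _ _) (hm.stronglyMeasurableAtFilter _ _) hm.continuousAt)
  have := ((hasDerivAt_id x).const_add 1).rpow_const (p := -s) (Or.inl (by simp; linarith))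
  simpa using this

/-- The reduced problem in the terminal time has a strict global minimum where `m` crosses
`s (1 + x)^{-s-1}` from below. -/
theorem terminalBound_lt (hm : Continuous m) {T x : ℝ} (hT : 0 ≤ T) (hx : 0 ≤ x)
    (hlt : ∀ y ∈ Ico 0 T, m y < s * (1 + y) ^ (-s - 1))
    (hgt : ∀ y, T < y → s * (1 + y) ^ (-s - 1) < m y) (hne : x ≠ T) :
    (1 + T) ^ (-s) + (∫ u in (0 : ℝ)..T, m u) < (1 + x) ^ (-s) + ∫ u in (0 : ℝ)..x, m u := by
  have hd : ∀ y, 0 ≤ y → HasDerivAt (fun x => (1 + x) ^ (-s) + ∫ u in (0 : ℝ)..x, m u)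
      (-s * (1 + y) ^ (-s - 1) + m y) y := fun y hy => hasDerivAt_terminalBound hm hy
  rcases lt_or_gt_of_ne hne with h | h
  · refine strictAntiOn_of_deriv_neg (convex_Icc 0 T)
      (fun y hy => (hd y hy.1).continuousAt.continuousWithinAt) ?_ ⟨hx, h.le⟩ ⟨hT, le_rfl⟩ h
    intro y hy
    rw [interior_Icc] at hy
    rw [(hd y hy.1.le).deriv]
    linarith [hlt y ⟨hy.1.le, hy.2⟩]
  · refine strictMonoOn_of_deriv_pos (convex_Ici T)
      (fun y hy => (hd y (hT.trans hy)).continuousAt.continuousWithinAt) ?_ self_mem_Ici h.le h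
    intro y hy
    rw [interior_Ici] at hy
    rw [(hd y (hT.trans (le_of_lt hy))).deriv]
    linarith [hgt y hy]

/-- The comparison curve has its own cap `η₀`: it may violate the cap `η` and still bound the loss
from below. -/
theorem finalLoss_le_of_certificate {η₀ : ℝ} {t₀ : ℝ → ℝ} (hN : 0 ≤ N) (hm : Continuous m)
    (h₀ : IsAdmissible η₀ N t₀)
    (heq : ∀ᵐ z ∂(volume.restrict (Icc 0 N)),
      m (t₀ N - t₀ z) * deriv t₀ z
        = forgettingKernel β (t₀ N - t₀ z) * deriv t₀ z ^ 2 + lam)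
    (hlt : ∀ y ∈ Ico 0 (t₀ N), m y < s * (1 + y) ^ (-s - 1))
    (hgt : ∀ y, t₀ N < y → s * (1 + y) ^ (-s - 1) < m y)
    (h : IsAdmissible η N t)
    (hle : ∀ u, 0 ≤ u → ∀ v ∈ Icc 0 η, m u * v ≤ forgettingKernel β u * v ^ 2 + lam) :
    finalLoss β s N t₀ ≤ finalLoss β s N t := by
  rw [h₀.finalLoss_eq_certificate hN hm heq]
  have h1 := h.certificate_le_finalLoss (s := s) hN hm hle
  by_cases hT : t N = t₀ N
  · rwa [hT] at h1
  · have := terminalBound_lt hm (h₀.terminal_nonneg hN) (h.terminal_nonneg hN) hlt hgt hT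
    linarith

/-- A monotone feedback law and its starting value determine the trajectory. -/
theorem eqOn_of_feedback {η₀ T : ℝ} {φ t₀ : ℝ → ℝ} (hN : 0 ≤ N)
    (h : IsAdmissible η N t) (h₀ : IsAdmissible η₀ N t₀) (hT : t N = T) (hT₀ : t₀ N = T)
    (hφ : MonotoneOn φ (Icc 0 T))
    (ht : ∀ᵐ z ∂(volume.restrict (Icc 0 N)), deriv t z = φ (T - t z))
    (ht₀ : ∀ᵐ z ∂(volume.restrict (Icc 0 N)), deriv t₀ z = φ (T - t₀ z)) :
    EqOn t t₀ (Icc 0 N) := by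
  intro x hx
  have hac := h.absCont.sub h₀.absCont
  have hac2 := (hac.mul hac).mono (c := 0) (d := x) (by
    rw [uIcc_of_le hN, uIcc_of_le hx.1]; exact Icc_subset_Icc le_rfl hx.2)
  have hint := hac2.integral_deriv_eq_sub
  -- The derivative of `(t - t₀)²` is `2(t - t₀)(φ(T - t) - φ(T - t₀)) ≤ 0` because φ is monotone,
  -- and the square vanishes at `0`.
  have hneg : ∫ z in (0 : ℝ)..x, deriv ((t - t₀) * (t - t₀)) z ≤ 0 := by
    have hsub : Icc 0 x ⊆ Icc 0 N := Icc_subset_Icc le_rfl hx.2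
    have := intervalIntegral.integral_mono_ae_restrict hx.1 hac2.intervalIntegrable_deriv
      (intervalIntegrable_const (c := (0 : ℝ)))
      (ae_restrict_of_ae_restrict_of_subset hsub (by
        filter_upwards [h.ae_hasDerivAt hN, h₀.ae_hasDerivAt hN, ht, ht₀] with z h1 h2 h3 h4
        have hd := (h1.2.1.sub h2.2.1).mul (h1.2.1.sub h2.2.1)
        rw [hd.deriv, h3, h4]
        have m1 := h.remaining_mem h1.1
        have m2 := h₀.remaining_mem h1.1
        rw [hT] at m1
        rw [hT₀] at m2
        simp only [Pi.sub_apply]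
        rcases le_total (t z) (t₀ z) with hle | hle
        · have := hφ m2 m1 (by linarith)
          nlinarith
        · have := hφ m1 m2 (by linarith)
          nlinarith))
    simpa using this
  rw [hint] at hneg
  simp only [Pi.mul_apply, Pi.sub_apply, h.zero, h₀.zero] at hneg
  have : t x - t₀ x = 0 := by nlinarith [mul_self_nonneg (t x - t₀ x)]
  linarith

/-- The curve `t₀` attains the bound at its own terminal value. A different terminal value would
make the bound strictly larger, so optimality forces `t N = t₀ N`, then pointwise equality, which
`huniq` turns into the feedback law. -/
theorem IsOptimal.eqOn_of_certificate {φ t₀ : ℝ → ℝ} (hN : 0 ≤ N) (hm : Continuous m)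
    (h₀ : IsAdmissible η N t₀)
    (hφ : MonotoneOn φ (Icc 0 (t₀ N)))
    (hfeed : ∀ᵐ z ∂(volume.restrict (Icc 0 N)), deriv t₀ z = φ (t₀ N - t₀ z))
    (heq : ∀ u, 0 ≤ u → m u * φ u = forgettingKernel β u * φ u ^ 2 + lam)
    (hlt : ∀ y ∈ Ico 0 (t₀ N), m y < s * (1 + y) ^ (-s - 1))
    (hgt : ∀ y, t₀ N < y → s * (1 + y) ^ (-s - 1) < m y)
    (hle : ∀ u, 0 ≤ u → ∀ v ∈ Icc 0 η, m u * v ≤ forgettingKernel β u * v ^ 2 + lam)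
    (huniq : ∀ u, 0 ≤ u → ∀ v ∈ Icc 0 η, m u * v = forgettingKernel β u * v ^ 2 + lam → v = φ u)
    (h : IsOptimal β s η N t) :
    EqOn t t₀ (Icc 0 N) := by
  have heq₀ : ∀ᵐ z ∂(volume.restrict (Icc 0 N)), m (t₀ N - t₀ z) * deriv t₀ z
        = forgettingKernel β (t₀ N - t₀ z) * deriv t₀ z ^ 2 + lam := by
    filter_upwards [hfeed, ae_restrict_mem measurableSet_Icc] with z hz hm
    rw [hz]
    exact heq _ (h₀.remaining_mem hm).1
  have hF₀ := h₀.finalLoss_eq_certificate (s := s) hN hm heq₀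
  have hopt : finalLoss β s N t ≤ finalLoss β s N t₀ := h.2 h₀
  have h1 := h.1.certificate_le_finalLoss (s := s) hN hm hle
  have hT : t N = t₀ N := by
    by_contra hT
    have := terminalBound_lt hm (h₀.terminal_nonneg hN) (h.1.terminal_nonneg hN) hlt hgt hT
    linarith
  have hae := h.1.ae_eq_of_finalLoss_le_certificate (s := s) hN hm hle (by
    rw [hT]; linarith)
  refine eqOn_of_feedback hN h.1 h₀ hT rfl hφ ?_ hfeed
  filter_upwards [hae, h.1.ae_hasDerivAt hN] with z hz hz'
  have := huniq _ (h.1.remaining_mem hz'.1).1 _ hz'.2.2 hz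
  rwa [hT] at this

end Certificate

/-! ### The power-decay curve and the upper bound it gives -/

theorem hasDerivAt_sub_affine_rpow {β κ a b z₀ z : ℝ} (hz : 0 < b - κ * (z - z₀)) :
    HasDerivAt (fun z => a - (b - κ * (z - z₀)) ^ (2 * β))
      (2 * β * κ * (b - κ * (z - z₀)) ^ (2 * β - 1)) z := by
  have h1 : HasDerivAt (fun z => b - κ * (z - z₀)) (-κ) z := by
    simpa using (((hasDerivAt_id z).sub_const z₀).const_mul κ).const_sub b
  have h2 := (h1.rpow_const (p := 2 * β) (Or.inl hz.ne')).const_sub a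
  refine h2.congr_deriv ?_
  ring

/-- The schedule along which `(1 + t(N) - t(z))^{1/(2β)}` decreases linearly from `W` to `1`. -/
noncomputable def powerDecay (β W N z : ℝ) : ℝ :=
  W ^ (2 * β) - (W - (W - 1) / N * (z - 0)) ^ (2 * β)

section PowerDecay

variable {β W N : ℝ}

theorem powerDecay_base_mem (hW : 1 ≤ W) (hN : 0 < N) {z : ℝ} (hz : z ∈ Icc 0 N) :
    W - (W - 1) / N * (z - 0) ∈ Icc 1 W := by
  have h1 : (W - 1) / N * (z - 0) = (W - 1) * (z / N) := by ring
  have h2 : 0 ≤ z / N := div_nonneg hz.1 hN.le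
  have h3 : z / N ≤ 1 := (div_le_one hN).2 hz.2
  rw [h1]
  constructor <;> nlinarith

theorem powerDecay_zero : powerDecay β W N 0 = 0 := by simp [powerDecay]

theorem powerDecay_terminal (hN : 0 < N) : powerDecay β W N N = W ^ (2 * β) - 1 := by
  have : W - (W - 1) / N * (N - 0) = 1 := by field_simp; ring
  rw [powerDecay, this, Real.one_rpow]

theorem powerDecay_remaining (hN : 0 < N) (z : ℝ) :
    1 + (powerDecay β W N N - powerDecay β W N z)
      = (W - (W - 1) / N * (z - 0)) ^ (2 * β) := by
  rw [powerDecay_terminal hN, powerDecay]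
  ring

/-- The `z - 0` in `powerDecay` matches `hasDerivAt_sub_affine_rpow` at `z₀ = 0`; `stableDecay` uses
it at `z₀ = N₁`. -/
theorem hasDerivWithinAt_powerDecay (hW : 1 ≤ W) (hN : 0 < N) {z : ℝ} (hz : z ∈ Icc 0 N) :
    HasDerivWithinAt (powerDecay β W N)
      (2 * β * ((W - 1) / N) * (W - (W - 1) / N * (z - 0)) ^ (2 * β - 1)) (Icc 0 N) z :=
  (hasDerivAt_sub_affine_rpow
    (lt_of_lt_of_le one_pos (powerDecay_base_mem hW hN hz).1)).hasDerivWithinAt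

theorem isAdmissible_powerDecay (hβ : 1 < β) (hW : 1 ≤ W) (hN : 0 < N) {η : ℝ}
    (hη : 2 * β * ((W - 1) / N) * W ^ (2 * β - 1) ≤ η) :
    IsAdmissible η N (powerDecay β W N) := by
  refine isAdmissible_of_hasDerivWithinAt hN.le powerDecay_zero
    (fun z hz => hasDerivWithinAt_powerDecay hW hN hz) fun z hz => ?_
  have hb := powerDecay_base_mem hW hN hz
  have hb0 : 0 ≤ W - (W - 1) / N * (z - 0) := zero_le_one.trans hb.1
  have hc : 0 ≤ 2 * β * ((W - 1) / N) :=
    mul_nonneg (by linarith) (div_nonneg (by linarith) hN.le)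
  refine ⟨mul_nonneg hc (Real.rpow_nonneg hb0 _), le_trans ?_ hη⟩
  exact mul_le_mul_of_nonneg_left (Real.rpow_le_rpow hb0 hb.2 (by linarith)) hc

theorem one_add_terminal_powerDecay (hW : 1 ≤ W) (hN : 0 < N) (s : ℝ) :
    (1 + powerDecay β W N N) ^ (-s) = W ^ (-(2 * β * s)) := by
  rw [powerDecay_terminal hN, add_sub_cancel, ← Real.rpow_mul (by linarith)]
  congr 1
  ring

theorem finalLoss_powerDecay (hβ : 1 < β) (hW : 1 ≤ W) (hN : 0 < N) (s : ℝ) :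
    finalLoss β s N (powerDecay β W N)
      = W ^ (-(2 * β * s)) + 4 * β ^ 2 * (W - 1) ^ 2 / N := by
  have hcongr : ∫ z in (0 : ℝ)..N, forgettingKernel β (powerDecay β W N N - powerDecay β W N z)
      * (deriv (powerDecay β W N) z) ^ 2 = ∫ _z in (0 : ℝ)..N, (2 * β * ((W - 1) / N)) ^ 2 := by
    refine intervalIntegral.integral_congr_ae_restrict ?_
    rw [uIoc_of_le hN.le]
    filter_upwards [ae_restrict_of_ae_restrict_of_subset Ioc_subset_Icc_self
      (ae_deriv_eq_of_hasDerivWithinAt fun z hz =>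
        hasDerivWithinAt_powerDecay (β := β) hW hN hz)] with z hz
    have hb : 0 < W - (W - 1) / N * (z - 0) :=
      lt_of_lt_of_le one_pos (powerDecay_base_mem hW hN hz.1).1
    rw [hz.2, forgettingKernel, powerDecay_remaining hN, ← Real.rpow_mul hb.le, mul_pow,
      ← Real.rpow_natCast (_ ^ (2 * β - 1)), ← Real.rpow_mul hb.le, mul_left_comm,
      ← Real.rpow_add hb]
    -- The powers of the base cancel, so the running cost is constant along this curve.
    have : 2 * β * -(2 - 1 / β) + (2 * β - 1) * ((2 : ℕ) : ℝ) = 0 := by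
      push_cast
      field_simp
      ring
    rw [this, Real.rpow_zero, mul_one]
  rw [finalLoss, hcongr, one_add_terminal_powerDecay hW hN, intervalIntegral.integral_const,
    smul_eq_mul]
  field_simp
  ring

end PowerDecay

/-- The competitor is a power decay with `W^{2β}` of order `N^θ`. Its terminal loss is of order
`N^{-θs}` and its running cost at most of order `N^{θ/β-1}`; `θ ≤ 1` keeps the peak rate below the
cap. -/
theorem eventually_finalLoss_le {β s η θ : ℝ} (hβ : 1 < β) (hη : 0 < η)
    (hθ0 : 0 < θ) (hθ1 : θ ≤ 1) (hθ : θ * s ≤ 1 - θ / β) :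
    ∃ C : ℝ, 0 < C ∧ ∀ᶠ N : ℝ in atTop, ∀ t : ℝ → ℝ, IsOptimal β s η N t →
      finalLoss β s N t ≤ C * N ^ (-(θ * s)) := by
  have hβ0 : 0 < β := by linarith
  set a : ℝ := (η / (2 * β)) ^ (1 / (2 * β)) with ha_def
  have ha : 0 < a := by positivity
  have ha2 : a ^ (2 * β) = η / (2 * β) := by
    rw [ha_def, ← Real.rpow_mul (by positivity), one_div_mul_cancel (by positivity), Real.rpow_one]
  refine ⟨a ^ (-(2 * β * s)) + 4 * β ^ 2 * a ^ 2, by positivity, ?_⟩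
  have hlim : Tendsto (fun N : ℝ => a * N ^ (θ / (2 * β))) atTop atTop :=
    (tendsto_rpow_atTop (by positivity)).const_mul_atTop ha
  filter_upwards [hlim.eventually_ge_atTop 1, eventually_ge_atTop 1] with N hW hN1 t ht
  have hN : 0 < N := by linarith
  set W := a * N ^ (θ / (2 * β)) with hWdef
  have hW0 : 0 < W := by linarith
  have hW2β : W ^ (2 * β) = η / (2 * β) * N ^ θ := by
    rw [hWdef, Real.mul_rpow ha.le (by positivity), ha2, ← Real.rpow_mul hN.le]
    congr 2
    field_simp
  have hadm : IsAdmissible η N (powerDecay β W N) := by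
    refine isAdmissible_powerDecay hβ hW hN ?_
    calc 2 * β * ((W - 1) / N) * W ^ (2 * β - 1) ≤ 2 * β * (W / N) * W ^ (2 * β - 1) := by
          gcongr
          linarith
      _ = 2 * β * W ^ (2 * β) / N := by
          rw [Real.rpow_sub_one hW0.ne']
          field_simp
      _ = η * (N ^ θ / N) := by
          rw [hW2β]
          field_simp
      _ ≤ η * 1 := by
          gcongr
          rw [div_le_one hN]
          simpa using Real.rpow_le_rpow_of_exponent_le hN1 hθ1
      _ = η := mul_one η
  refine (ht.2 hadm).trans ?_
  rw [finalLoss_powerDecay hβ hW hN, add_mul]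
  refine add_le_add (le_of_eq ?_) ?_
  · rw [hWdef, Real.mul_rpow ha.le (by positivity), ← Real.rpow_mul hN.le]
    congr 2
    field_simp
  · have hsq : W ^ 2 = a ^ 2 * N ^ (θ / β) := by
      rw [hWdef, mul_pow, ← Real.rpow_natCast (N ^ _), ← Real.rpow_mul hN.le]
      congr 2
      push_cast
      field_simp
    calc 4 * β ^ 2 * (W - 1) ^ 2 / N ≤ 4 * β ^ 2 * W ^ 2 / N := by
          have h1 : 0 ≤ W - 1 := by linarith
          gcongr
          linarith
      _ = 4 * β ^ 2 * a ^ 2 * N ^ (θ / β - 1) := by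
          rw [hsq, Real.rpow_sub_one hN.ne']
          ring
      _ ≤ 4 * β ^ 2 * a ^ 2 * N ^ (-(θ * s)) := by
          gcongr
          linarith

/-! ### Easy task: the uncapped calibration -/

section EasyTask

variable {β s W N : ℝ}

/-- The unconstrained certificate, extended by a constant to negative arguments. -/
noncomputable def unconstrainedPrice (β σ u : ℝ) : ℝ := 2 * σ * (1 + max u 0) ^ (-(1 - 1 / (2 * β)))

theorem continuous_unconstrainedPrice (β σ : ℝ) : Continuous (unconstrainedPrice β σ) := by
  unfold unconstrainedPrice
  refine Continuous.mul continuous_const (Continuous.rpow_const (by fun_prop) fun u => Or.inl ?_)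
  have := le_max_right u 0
  linarith

theorem forgettingKernel_eq_sq (β : ℝ) {u : ℝ} (hu : 0 ≤ u) :
    forgettingKernel β u = ((1 + u) ^ (-(1 - 1 / (2 * β)))) ^ 2 := by
  rw [forgettingKernel, ← Real.rpow_natCast, ← Real.rpow_mul (by linarith)]
  congr 1
  push_cast
  ring

/-- Completing the square in `a v - σ` gives both the pointwise bound and its equality case. -/
theorem kernel_sub_unconstrainedPrice {β σ u : ℝ} (hu : 0 ≤ u) (v : ℝ) :
    forgettingKernel β u * v ^ 2 + σ ^ 2 - unconstrainedPrice β σ u * v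
      = ((1 + u) ^ (-(1 - 1 / (2 * β))) * v - σ) ^ 2 := by
  rw [forgettingKernel_eq_sq β hu, unconstrainedPrice, max_eq_left hu]
  ring

/-- The value of σ is the one for which price and marginal gain agree at `1 + y = W^{2β}`. With the
common factor `a(y)` split off here and in `marginal_gain_eq`, the crossing reduces to monotonicity
of one negative power. -/
theorem unconstrainedPrice_eq (hβ : 1 < β) (hW : 1 ≤ W) {y : ℝ} (hy : 0 ≤ y) :
    unconstrainedPrice β (s / 2 * W ^ (-(2 * β * s + 1))) y
      = s * (W ^ (2 * β)) ^ (-(s + 1 / (2 * β))) * (1 + y) ^ (-(1 - 1 / (2 * β))) := by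
  have h2 : (W ^ (2 * β)) ^ (-(s + 1 / (2 * β))) = W ^ (-(2 * β * s + 1)) := by
    rw [← Real.rpow_mul (by linarith)]
    congr 1
    field_simp
  rw [unconstrainedPrice, max_eq_left hy, h2]
  ring

theorem marginal_gain_eq (β s : ℝ) {y : ℝ} (hy : 0 ≤ y) :
    s * (1 + y) ^ (-s - 1)
      = s * (1 + y) ^ (-(s + 1 / (2 * β))) * (1 + y) ^ (-(1 - 1 / (2 * β))) := by
  rw [mul_assoc, ← Real.rpow_add (by linarith)]
  congr 2
  ring

theorem unconstrainedPrice_lt (hβ : 1 < β) (hs : 0 < s) (hW : 1 ≤ W) {y : ℝ} (hy : 0 ≤ y)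
    (hlt : 1 + y < W ^ (2 * β)) :
    unconstrainedPrice β (s / 2 * W ^ (-(2 * β * s + 1))) y < s * (1 + y) ^ (-s - 1) := by
  rw [unconstrainedPrice_eq hβ hW hy, marginal_gain_eq β s hy]
  have : 0 < (1 + y) ^ (-(1 - 1 / (2 * β))) := Real.rpow_pos_of_pos (by linarith) _
  have he : 0 < s + 1 / (2 * β) := by positivity
  refine mul_lt_mul_of_pos_right (mul_lt_mul_of_pos_left ?_ hs) this
  exact Real.rpow_lt_rpow_of_neg (by linarith) hlt (neg_lt_zero.2 he)

theorem lt_unconstrainedPrice (hβ : 1 < β) (hs : 0 < s) (hW : 1 ≤ W) {y : ℝ} (hy : 0 ≤ y)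
    (hlt : W ^ (2 * β) < 1 + y) :
    s * (1 + y) ^ (-s - 1) < unconstrainedPrice β (s / 2 * W ^ (-(2 * β * s + 1))) y := by
  rw [unconstrainedPrice_eq hβ hW hy, marginal_gain_eq β s hy]
  have : 0 < (1 + y) ^ (-(1 - 1 / (2 * β))) := Real.rpow_pos_of_pos (by linarith) _
  have he : 0 < s + 1 / (2 * β) := by positivity
  refine mul_lt_mul_of_pos_right (mul_lt_mul_of_pos_left ?_ hs) this
  exact Real.rpow_lt_rpow_of_neg (Real.rpow_pos_of_pos (by linarith) _) hlt (neg_lt_zero.2 he)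

/-- The horizon equation says that the slope which brings the base from `W` to `1` in time `N`
yields the σ demanded by the terminal condition. -/
theorem powerDecay_slope (hβ : 1 < β) (hs : 0 < s) (hW : 1 < W)
    (hWN : N = 4 * β / s * ((W - 1) * W ^ (2 * β * s + 1))) :
    2 * β * ((W - 1) / N) = s / 2 * W ^ (-(2 * β * s + 1)) := by
  have hW0 : 0 < W := by linarith
  have h1 : W - 1 ≠ 0 := by linarith
  have h2 : W ^ (2 * β * s + 1) ≠ 0 := (Real.rpow_pos_of_pos hW0 _).ne'
  rw [Real.rpow_neg hW0.le, hWN]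
  field_simp
  norm_num

theorem powerDecay_feedback (hβ : 1 < β) (hs : 0 < s) (hW : 1 < W) (hN : 0 < N)
    (hWN : N = 4 * β / s * ((W - 1) * W ^ (2 * β * s + 1))) :
    ∀ᵐ z ∂(volume.restrict (Icc 0 N)), deriv (powerDecay β W N) z =
      s / 2 * W ^ (-(2 * β * s + 1))
        * (1 + (powerDecay β W N N - powerDecay β W N z)) ^ (1 - 1 / (2 * β)) := by
  filter_upwards [ae_deriv_eq_of_hasDerivWithinAt fun z hz =>
    hasDerivWithinAt_powerDecay (β := β) hW.le hN hz] with z hz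
  have hb := powerDecay_base_mem hW.le hN hz.1
  rw [hz.2, powerDecay_remaining hN, ← Real.rpow_mul (by linarith [hb.1]),
    powerDecay_slope hβ hs hW hWN]
  congr 2
  field_simp

theorem unconstrainedPrice_mul_feedback {σ u : ℝ} (hu : 0 ≤ u) :
    unconstrainedPrice β σ u * (σ * (1 + u) ^ (1 - 1 / (2 * β)))
      = forgettingKernel β u * (σ * (1 + u) ^ (1 - 1 / (2 * β))) ^ 2 + σ ^ 2 := by
  have h := kernel_sub_unconstrainedPrice (β := β) (σ := σ) hu (σ * (1 + u) ^ (1 - 1 / (2 * β)))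
  have hφ : (1 + u) ^ (-(1 - 1 / (2 * β))) * (σ * (1 + u) ^ (1 - 1 / (2 * β))) = σ := by
    rw [mul_left_comm, ← Real.rpow_add (by linarith), neg_add_cancel, Real.rpow_zero, mul_one]
  rw [hφ, sub_self] at h
  linarith

theorem powerDecay_finalLoss_le (hβ : 1 < β) (hs : 0 < s) (hW : 1 < W) (hN : 0 < N)
    (hWN : N = 4 * β / s * ((W - 1) * W ^ (2 * β * s + 1))) {η : ℝ} {t : ℝ → ℝ}
    (ht : IsAdmissible η N t) :
    finalLoss β s N (powerDecay β W N) ≤ finalLoss β s N t := by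
  have h₀ := isAdmissible_powerDecay hβ hW.le hN le_rfl
  have hterm : 1 + powerDecay β W N N = W ^ (2 * β) := by
    rw [powerDecay_terminal hN]; ring
  refine finalLoss_le_of_certificate hN.le
    (continuous_unconstrainedPrice β (s / 2 * W ^ (-(2 * β * s + 1)))) h₀
    (lam := (s / 2 * W ^ (-(2 * β * s + 1))) ^ 2) ?_ ?_ ?_ ht ?_
  · filter_upwards [powerDecay_feedback hβ hs hW hN hWN, ae_restrict_mem measurableSet_Icc]
      with z hz hm
    rw [hz]
    exact unconstrainedPrice_mul_feedback (h₀.remaining_mem hm).1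
  · exact fun y hy => unconstrainedPrice_lt hβ hs hW.le hy.1 (by linarith [hy.2])
  · exact fun y hy => lt_unconstrainedPrice hβ hs hW.le
      ((h₀.terminal_nonneg hN.le).trans hy.le) (by linarith)
  · intro u hu v _
    have := kernel_sub_unconstrainedPrice (β := β) (σ := s / 2 * W ^ (-(2 * β * s + 1))) hu v
    nlinarith [sq_nonneg ((1 + u) ^ (-(1 - 1 / (2 * β))) * v - s / 2 * W ^ (-(2 * β * s + 1)))]

theorem IsOptimal.eqOn_powerDecay (hβ : 1 < β) (hs : 0 < s) (hW : 1 < W) (hN : 0 < N)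
    (hWN : N = 4 * β / s * ((W - 1) * W ^ (2 * β * s + 1))) {η : ℝ} {t : ℝ → ℝ}
    (h₀ : IsAdmissible η N (powerDecay β W N)) (ht : IsOptimal β s η N t) :
    EqOn t (powerDecay β W N) (Icc 0 N) := by
  have hterm : 1 + powerDecay β W N N = W ^ (2 * β) := by
    rw [powerDecay_terminal hN]; ring
  have hW0 : 0 < W := by linarith
  have hσ : 0 < s / 2 * W ^ (-(2 * β * s + 1)) := by positivity
  have hβ' : 1 / (2 * β) ≤ 1 := by
    rw [div_le_one (by linarith)]; linarith
  refine IsOptimal.eqOn_of_certificate hN.le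
    (continuous_unconstrainedPrice β (s / 2 * W ^ (-(2 * β * s + 1)))) h₀
    (lam := (s / 2 * W ^ (-(2 * β * s + 1))) ^ 2)
    (φ := fun u => s / 2 * W ^ (-(2 * β * s + 1)) * (1 + u) ^ (1 - 1 / (2 * β)))
    ?_ (powerDecay_feedback hβ hs hW hN hWN) (fun u hu => unconstrainedPrice_mul_feedback hu)
    ?_ ?_ ?_ ?_ ht
  · intro x hx y hy hxy
    have := Real.rpow_le_rpow (by linarith [hx.1] : (0 : ℝ) ≤ 1 + x)
      (by linarith : 1 + x ≤ 1 + y) (by linarith : 0 ≤ 1 - 1 / (2 * β))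
    exact mul_le_mul_of_nonneg_left this hσ.le
  · exact fun y hy => unconstrainedPrice_lt hβ hs hW.le hy.1 (by linarith [hy.2])
  · exact fun y hy => lt_unconstrainedPrice hβ hs hW.le
      ((h₀.terminal_nonneg hN.le).trans hy.le) (by linarith)
  · intro u hu v _
    have := kernel_sub_unconstrainedPrice (β := β) (σ := s / 2 * W ^ (-(2 * β * s + 1))) hu v
    nlinarith [sq_nonneg ((1 + u) ^ (-(1 - 1 / (2 * β))) * v - s / 2 * W ^ (-(2 * β * s + 1)))]
  · intro u hu v _ heq
    have h1 := kernel_sub_unconstrainedPrice (β := β) (σ := s / 2 * W ^ (-(2 * β * s + 1))) hu v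
    rw [heq, sub_self, eq_comm, sq_eq_zero_iff, sub_eq_zero] at h1
    simp only [← h1]
    rw [mul_right_comm, ← Real.rpow_add (by linarith), neg_add_cancel, Real.rpow_zero, one_mul]

theorem exists_horizon_eq (hβ : 1 < β) (hs : 0 < s) (hN : 0 < N) :
    ∃ W, 1 < W ∧ N = 4 * β / s * ((W - 1) * W ^ (2 * β * s + 1)) := by
  have hβ0 : 0 < β := by linarith
  set f : ℝ → ℝ := fun W => 4 * β / s * ((W - 1) * W ^ (2 * β * s + 1)) with hf
  have hcont : ContinuousOn f (Ici 1) := by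
    refine continuousOn_const.mul (ContinuousOn.mul (by fun_prop) ?_)
    refine continuousOn_id.rpow_const fun x hx => Or.inl ?_
    have : (1 : ℝ) ≤ x := hx
    simp only [id]
    linarith
  -- At this point the factor `W - 1` alone already produces `N`, and the other power is at least
  -- `1`; at `W = 1` the function is zero.
  have hb : N ≤ f (1 + s * N / (4 * β)) := by
    have hx : 0 ≤ s * N / (4 * β) := by positivity
    have : 1 ≤ (1 + s * N / (4 * β)) ^ (2 * β * s + 1) :=
      Real.one_le_rpow (by linarith) (by positivity)
    calc N = 4 * β / s * (s * N / (4 * β) * 1) := by field_simp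
      _ ≤ 4 * β / s * (s * N / (4 * β) * (1 + s * N / (4 * β)) ^ (2 * β * s + 1)) := by gcongr
      _ = f (1 + s * N / (4 * β)) := by simp [hf]
  have hle : (1 : ℝ) ≤ 1 + s * N / (4 * β) := by
    have : 0 ≤ s * N / (4 * β) := by positivity
    linarith
  obtain ⟨W, hW, hWN⟩ := intermediate_value_Icc hle (hcont.mono Icc_subset_Ici_self)
    (show N ∈ Icc (f 1) _ from ⟨by simp [hf, hN.le], hb⟩)
  refine ⟨W, lt_of_le_of_ne hW.1 ?_, hWN.symm⟩
  rintro rfl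
  simp [hf] at hWN
  exact hN.ne hWN

/-- The product `(W-1) W^{2βs+1}` lies between the powers `2βs+2` of `W - 1` and of `W`; the lower
bound on `N` forces `W ≥ 2`, making the two comparable. -/
theorem horizon_bounds (hβ : 1 < β) (hs : 0 < s) (hW : 1 < W)
    (hN : 4 * β / s * (2 : ℝ) ^ (2 * β * s + 1) ≤ N)
    (hWN : N = 4 * β / s * ((W - 1) * W ^ (2 * β * s + 1))) :
    (s * N / (4 * β)) ^ (1 / (2 * β * s + 2)) ≤ W ∧
      W / 2 ≤ W - 1 ∧ W - 1 ≤ (s * N / (4 * β)) ^ (1 / (2 * β * s + 2)) := by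
  have hβ0 : 0 < β := by linarith
  have hW0 : 0 < W := by linarith
  have he : 0 < 2 * β * s + 1 := by positivity
  have he2 : 2 * β * s + 2 ≠ 0 := by positivity
  have hW2 : 2 ≤ W := by
    by_contra hlt
    push Not at hlt
    have : (W - 1) * W ^ (2 * β * s + 1) < 1 * 2 ^ (2 * β * s + 1) :=
      mul_lt_mul (by linarith) (Real.rpow_le_rpow hW0.le hlt.le he.le) (by positivity) zero_le_one
    rw [one_mul] at this
    have h4 : 0 < 4 * β / s := by positivity
    have := mul_lt_mul_of_pos_left this h4
    linarith
  have hx : s * N / (4 * β) = (W - 1) * W ^ (2 * β * s + 1) := by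
    rw [hWN]
    field_simp
  have hpow : ∀ x : ℝ, 0 < x → x * x ^ (2 * β * s + 1) = x ^ (2 * β * s + 2) := fun x hx => by
    rw [show 2 * β * s + 2 = (2 * β * s + 1) + 1 by ring, Real.rpow_add_one hx.ne' (2 * β * s + 1),
      mul_comm]
  have hroot : ∀ x : ℝ, 0 < x → (x ^ (2 * β * s + 2)) ^ (1 / (2 * β * s + 2)) = x := fun x hx => by
    rw [← Real.rpow_mul hx.le, mul_one_div_cancel he2, Real.rpow_one]
  refine ⟨?_, by linarith, ?_⟩
  · rw [hx]
    refine le_of_le_of_eq ?_ (hroot W hW0)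
    refine Real.rpow_le_rpow (mul_nonneg (by linarith) (by positivity)) ?_ (by positivity)
    rw [← hpow W hW0]
    gcongr
    linarith
  · have hW1 : 0 < W - 1 := by linarith
    rw [hx]
    refine le_of_eq_of_le (hroot _ hW1).symm ?_
    refine Real.rpow_le_rpow (by positivity) ?_ (by positivity)
    rw [← hpow _ hW1]
    gcongr
    linarith

theorem easyTask_rate (hβ : 1 < β) (hs : 0 < s) {η : ℝ} (hη : 0 < η) (hsβ : 1 - 1 / β ≤ s) :
    ∃ c C : ℝ, 0 < c ∧ 0 < C ∧
      ∀ᶠ N : ℝ in atTop, ∀ t : ℝ → ℝ, IsOptimal β s η N t →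
        c * N ^ (-(s * β / (s * β + 1))) ≤ finalLoss β s N t ∧
        finalLoss β s N t ≤ C * N ^ (-(s * β / (s * β + 1))) := by
  have hβ0 : 0 < β := by linarith
  have hθ1 : β / (1 + β * s) ≤ 1 := by
    rw [div_le_one (by positivity)]
    have : β * (1 - 1 / β) ≤ β * s := by gcongr
    rw [mul_sub, mul_one_div_cancel hβ0.ne'] at this
    linarith
  -- This θ balances the two losses, `θs = 1 - θ/β`; it is at most `1` precisely when `s ≥ 1 - 1/β`.
  obtain ⟨C, hC, hCN⟩ := eventually_finalLoss_le (s := s) (θ := β / (1 + β * s)) hβ hη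
    (by positivity) hθ1 (by apply le_of_eq; field_simp; ring)
  refine ⟨2 ^ (-(2 * β * s)) * (s / (4 * β)) ^ (-(s * β / (s * β + 1))), C, by positivity, hC, ?_⟩
  filter_upwards [hCN, eventually_ge_atTop (4 * β / s * (2 : ℝ) ^ (2 * β * s + 1)),
    eventually_gt_atTop 0] with N hub hNlarge hN t ht
  constructor
  · obtain ⟨W, hW, hWN⟩ := exists_horizon_eq hβ hs hN
    obtain ⟨-, h2, h3⟩ := horizon_bounds hβ hs hW hNlarge hWN
    refine le_trans ?_ (powerDecay_finalLoss_le hβ hs hW hN hWN ht.1)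
    rw [finalLoss_powerDecay hβ hW.le hN]
    refine le_trans ?_ (le_add_of_nonneg_right (by positivity))
    calc _ = (2 * (s * N / (4 * β)) ^ (1 / (2 * β * s + 2))) ^ (-(2 * β * s)) := by
          rw [Real.mul_rpow (by positivity) (by positivity), ← Real.rpow_mul (by positivity),
            show s * N / (4 * β) = s / (4 * β) * N by ring,
            Real.mul_rpow (by positivity) hN.le,
            show 1 / (2 * β * s + 2) * -(2 * β * s) = -(s * β / (s * β + 1)) by
              field_simp]
          ring
      _ ≤ W ^ (-(2 * β * s)) := by
          refine Real.rpow_le_rpow_of_nonpos (by linarith) (by linarith) ?_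
          have : 0 < 2 * β * s := by positivity
          linarith
  · have := hub t ht
    rwa [show β / (1 + β * s) * s = s * β / (s * β + 1) by field_simp; ring] at this

/-- The initial rate is `(s/2) W^{-2β(s-(1-1/β))}`: it tends to zero above the critical exponent and
is constantly `s/2` at it, whence the condition on the cap. -/
theorem eventually_peak_rate_le (hβ : 1 < β) (hs : 0 < s) {η : ℝ} (hη : 0 < η)
    (hsβ : 1 - 1 / β < s ∨ (s = 1 - 1 / β ∧ (1 - 1 / β) / 2 ≤ η)) :
    ∀ᶠ R : ℝ in atTop, ∀ W, R ≤ W →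
      s / 2 * W ^ (-(2 * β * s + 1)) * W ^ (2 * β - 1) ≤ η := by
  have hβ0 : 0 < β := by linarith
  have hmul : ∀ W : ℝ, 0 < W → s / 2 * W ^ (-(2 * β * s + 1)) * W ^ (2 * β - 1)
      = s / 2 * W ^ (-(2 * β * (s - (1 - 1 / β)))) := fun W hW => by
    rw [mul_assoc, ← Real.rpow_add hW]
    congr 2
    field_simp
    ring
  rcases hsβ with hlt | ⟨heq, hle⟩
  · have he : 0 < 2 * β * (s - (1 - 1 / β)) := mul_pos (by positivity) (by linarith)
    have hlim := (tendsto_rpow_neg_atTop he).const_mul (s / 2)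
    rw [mul_zero] at hlim
    filter_upwards [hlim.eventually_le_const hη, eventually_gt_atTop 0] with R hR hR0 W hW
    rw [hmul W (hR0.trans_le hW)]
    refine le_trans ?_ hR
    refine mul_le_mul_of_nonneg_left ?_ (by positivity)
    exact Real.rpow_le_rpow_of_nonpos hR0 hW (neg_nonpos.2 he.le)
  · filter_upwards [eventually_gt_atTop 0] with R hR0 W hW
    rw [hmul W (hR0.trans_le hW), heq]
    simpa using hle

theorem easyTask_schedule (hβ : 1 < β) (hs : 0 < s) {η : ℝ} (hη : 0 < η)
    (hsβ : 1 - 1 / β < s ∨ (s = 1 - 1 / β ∧ (1 - 1 / β) / 2 ≤ η)) :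
    ∃ c C : ℝ, 0 < c ∧ 0 < C ∧ ∃ ρ : ℝ → ℝ, Tendsto ρ atTop (𝓝 0) ∧
      ∀ᶠ N : ℝ in atTop, ∀ t : ℝ → ℝ, IsOptimal β s η N t →
        ∃ ηpeak δ : ℝ, |δ| ≤ ρ N ∧
          c * N ^ (-((1 + s * β - β) / (1 + s * β))) ≤ ηpeak ∧
          ηpeak ≤ C * N ^ (-((1 + s * β - β) / (1 + s * β))) ∧
          ∀ z ∈ Icc 0 N, 0 ≤ 1 + δ - z / N ∧
            HasDerivWithinAt t (ηpeak * (1 + δ - z / N) ^ (2 * β - 1)) (Icc 0 N) z := by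
  have hβ0 : 0 < β := by linarith
  set e : ℝ := 1 / (2 * β * s + 2) with he
  have he0 : 0 < e := by positivity
  have hR : Tendsto (fun N : ℝ => (s * N / (4 * β)) ^ e) atTop atTop := by
    refine (tendsto_rpow_atTop he0).comp ?_
    have : Tendsto (fun N : ℝ => s / (4 * β) * N) atTop atTop :=
      tendsto_id.const_mul_atTop (by positivity)
    refine this.congr fun N => ?_
    ring
  have hR2β : ∀ N : ℝ, 0 < N → 2 * β * ((s * N / (4 * β)) ^ e) ^ (2 * β) / N
      = 2 * β * (s / (4 * β)) ^ (e * (2 * β)) * N ^ (-((1 + s * β - β) / (1 + s * β))) := by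
    intro N hN
    rw [show s * N / (4 * β) = s / (4 * β) * N by ring, Real.mul_rpow (by positivity) hN.le,
      Real.mul_rpow (by positivity) (by positivity), ← Real.rpow_mul (by positivity),
      ← Real.rpow_mul hN.le,
      show -((1 + s * β - β) / (1 + s * β)) = e * (2 * β) - 1 by rw [he]; field_simp; ring,
      Real.rpow_sub_one hN.ne']
    ring
  refine ⟨(1 / 2) ^ (2 * β) * (2 * β * (s / (4 * β)) ^ (e * (2 * β))),
    2 * β * (s / (4 * β)) ^ (e * (2 * β)), by positivity, by positivity,
    fun N => 2 * ((s * N / (4 * β)) ^ e)⁻¹, ?_, ?_⟩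
  · simpa using hR.inv_tendsto_atTop.const_mul 2
  filter_upwards [eventually_ge_atTop (4 * β / s * (2 : ℝ) ^ (2 * β * s + 1)),
    eventually_gt_atTop 0, hR.eventually (eventually_peak_rate_le hβ hs hη hsβ)]
    with N hNlarge hN hpeak t ht
  obtain ⟨W, hW, hWN⟩ := exists_horizon_eq hβ hs hN
  obtain ⟨h1, h2, h3⟩ := horizon_bounds hβ hs hW hNlarge hWN
  rw [← he] at h1 h3
  have hRpos : 0 < (s * N / (4 * β)) ^ e := by positivity
  set R := (s * N / (4 * β)) ^ e
  have hW1 : 0 < W - 1 := by linarith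
  have hW0 : 0 < W := by linarith
  have h₀ : IsAdmissible η N (powerDecay β W N) := by
    refine isAdmissible_powerDecay hβ hW.le hN ?_
    rw [powerDecay_slope hβ hs hW hWN]
    exact hpeak W h1
  have heq := ht.eqOn_powerDecay hβ hs hW hN hWN h₀
  have hpeak_eq : 2 * β * ((W - 1) / N) * (W - 1) ^ (2 * β - 1) = 2 * β * (W - 1) ^ (2 * β) / N := by
    rw [Real.rpow_sub_one hW1.ne']
    field_simp
  -- Factoring `W - 1` out of the affine base leaves `1 + 1/(W-1) - z/N`, so `δ = 1/(W-1)`; the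
  -- bound `2/R` on δ comes from `W - 1 ≥ W/2 ≥ R/2`.
  refine ⟨2 * β * ((W - 1) / N) * (W - 1) ^ (2 * β - 1), 1 / (W - 1), ?_, ?_, ?_, ?_⟩
  · rw [abs_of_pos (by positivity), ← div_eq_mul_inv, div_le_div_iff₀ hW1 hRpos]
    linarith
  · rw [hpeak_eq, mul_assoc, ← hR2β N hN]
    calc _ = 2 * β * (1 / 2 * R) ^ (2 * β) / N := by
          rw [Real.mul_rpow (by norm_num) hRpos.le]
          ring
      _ ≤ _ := by
          gcongr
          linarith
  · rw [hpeak_eq, ← hR2β N hN]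
    gcongr
  · intro z hz
    have hb := powerDecay_base_mem hW.le hN hz
    have hbase : W - (W - 1) / N * (z - 0) = (W - 1) * (1 + 1 / (W - 1) - z / N) := by
      field_simp
      ring
    have hpos : 0 ≤ 1 + 1 / (W - 1) - z / N := by
      by_contra hneg
      push Not at hneg
      have := mul_neg_of_pos_of_neg hW1 hneg
      linarith [hb.1]
    refine ⟨hpos, ?_⟩
    have hd := (hasDerivWithinAt_powerDecay (β := β) hW.le hN hz).congr heq (heq hz)
    refine hd.congr_deriv ?_
    rw [hbase, Real.mul_rpow hW1.le hpos]
    ring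

end EasyTask

/-! ### Calibration under an active cap -/

section ConstrainedPrice

/-- With `φ = min η (σ / a)`, the price `a² φ + σ² / φ` supports `v ↦ a² v² + σ²` on `[0, η]`
from below, touching it exactly at `φ`. -/
theorem supporting_price {a σ η v : ℝ} (ha : 0 < a) (hσ : 0 < σ) (hη : 0 < η) (hv : v ≤ η) :
    (a ^ 2 * min η (σ / a) + σ ^ 2 / min η (σ / a)) * v ≤ a ^ 2 * v ^ 2 + σ ^ 2 ∧
      ((a ^ 2 * min η (σ / a) + σ ^ 2 / min η (σ / a)) * v = a ^ 2 * v ^ 2 + σ ^ 2 →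
        v = min η (σ / a)) := by
  rcases le_total η (σ / a) with h | h
  · rw [min_eq_left h]
    rw [le_div_iff₀ ha] at h
    -- With the cap active the slack is not a square, but both factors are nonnegative since `v ≤ η`
    -- and `aη ≤ σ`.
    have h1 : a ^ 2 * v ^ 2 + σ ^ 2 - (a ^ 2 * η + σ ^ 2 / η) * v
        = (η - v) * (σ ^ 2 / η - a ^ 2 * v) := by
      field_simp
      ring
    have h2 : a ^ 2 * η ≤ σ ^ 2 / η := by
      rw [le_div_iff₀ hη]
      have : 0 < η * a := by positivity
      nlinarith
    have h3 : a ^ 2 * v ≤ a ^ 2 * η := by gcongr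
    refine ⟨?_, fun heq => ?_⟩
    · have := mul_nonneg (by linarith : 0 ≤ η - v) (by linarith : 0 ≤ σ ^ 2 / η - a ^ 2 * v)
      linarith
    · rw [heq, sub_self, eq_comm, mul_eq_zero] at h1
      rcases h1 with h1 | h1
      · linarith
      · have : a ^ 2 * η ≤ a ^ 2 * v := by linarith
        exact le_antisymm hv (le_of_mul_le_mul_left this (by positivity))
  · rw [min_eq_right h]
    have h1 : a ^ 2 * v ^ 2 + σ ^ 2 - (a ^ 2 * (σ / a) + σ ^ 2 / (σ / a)) * v
        = (a * v - σ) ^ 2 := by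
      field_simp
      ring
    refine ⟨by nlinarith [sq_nonneg (a * v - σ)], fun heq => ?_⟩
    rw [heq, sub_self, eq_comm, sq_eq_zero_iff] at h1
    rw [eq_div_iff ha.ne']
    linarith

/-- The capped power law as a function of the remaining intrinsic time. -/
noncomputable def cappedRate (β η σ u : ℝ) : ℝ :=
  min η (σ * (1 + max u 0) ^ (1 - 1 / (2 * β)))

/-- The certificate for the problem with a cap on the learning rate. -/
noncomputable def cappedPrice (β η σ u : ℝ) : ℝ :=
  forgettingKernel β (max u 0) * cappedRate β η σ u + σ ^ 2 / cappedRate β η σ u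

variable {β s η σ Y : ℝ}

theorem cappedRate_pos (hσ : 0 < σ) (hη : 0 < η) (u : ℝ) : 0 < cappedRate β η σ u := by
  have := le_max_right u 0
  exact lt_min hη (mul_pos hσ (Real.rpow_pos_of_pos (by linarith) _))

theorem continuous_cappedRate : Continuous (cappedRate β η σ) := by
  unfold cappedRate
  refine continuous_const.min (continuous_const.mul
    (Continuous.rpow_const (by fun_prop) fun u => Or.inl ?_))
  have := le_max_right u 0
  linarith

theorem continuous_cappedPrice (hσ : 0 < σ) (hη : 0 < η) : Continuous (cappedPrice β η σ) := by
  have h := continuous_cappedRate (β := β) (η := η) (σ := σ)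
  refine Continuous.add (Continuous.mul ?_ h)
    (continuous_const.div h fun u => (cappedRate_pos hσ hη u).ne')
  exact (continuousOn_forgettingKernel β).comp_continuous (by fun_prop) fun u => le_max_right u 0

theorem cappedRate_eq_div {u : ℝ} (hu : 0 ≤ u) :
    cappedRate β η σ u = min η (σ / (1 + u) ^ (-(1 - 1 / (2 * β)))) := by
  rw [cappedRate, max_eq_left hu, Real.rpow_neg (by linarith), div_inv_eq_mul]

theorem cappedPrice_mul_le (hσ : 0 < σ) (hη : 0 < η) {u v : ℝ} (hu : 0 ≤ u) (hv : v ≤ η) :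
    cappedPrice β η σ u * v ≤ forgettingKernel β u * v ^ 2 + σ ^ 2 ∧
      (cappedPrice β η σ u * v = forgettingKernel β u * v ^ 2 + σ ^ 2 →
        v = cappedRate β η σ u) := by
  rw [cappedPrice, max_eq_left hu, cappedRate_eq_div hu, forgettingKernel_eq_sq β hu]
  exact supporting_price (Real.rpow_pos_of_pos (by linarith) _) hσ hη hv

theorem cappedPrice_mul_cappedRate (hσ : 0 < σ) (hη : 0 < η) {u : ℝ} (hu : 0 ≤ u) :
    cappedPrice β η σ u * cappedRate β η σ u
      = forgettingKernel β u * cappedRate β η σ u ^ 2 + σ ^ 2 := by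
  have := (cappedRate_pos (β := β) hσ hη u).ne'
  rw [cappedPrice, max_eq_left hu]
  field_simp

theorem monotoneOn_cappedRate (hβ : 1 < β) (hσ : 0 < σ) (T : ℝ) :
    MonotoneOn (cappedRate β η σ) (Icc 0 T) := by
  intro x hx y hy hxy
  have hβ' : 1 / (2 * β) ≤ 1 := by
    rw [div_le_one (by linarith)]; linarith
  rw [cappedRate, cappedRate, max_eq_left hx.1, max_eq_left hy.1]
  refine min_le_min_left _ (mul_le_mul_of_nonneg_left ?_ hσ.le)
  exact Real.rpow_le_rpow (by linarith [hx.1]) (by linarith) (by linarith)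

theorem cap_scale_mul (hY : 0 < Y) : η * Y ^ (-(1 - 1 / (2 * β))) * Y ^ (1 - 1 / (2 * β)) = η := by
  rw [mul_assoc, ← Real.rpow_add hY, neg_add_cancel, Real.rpow_zero, mul_one]

theorem cappedRate_of_ge (hβ : 1 < β) (hη : 0 < η) (hY : 0 < Y) {u : ℝ} (hu : 0 ≤ u)
    (h : Y ≤ 1 + u) : cappedRate β η (η * Y ^ (-(1 - 1 / (2 * β)))) u = η := by
  have hβ' : 1 / (2 * β) ≤ 1 := by
    rw [div_le_one (by linarith)]; linarith
  rw [cappedRate, max_eq_left hu, min_eq_left]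
  calc η = η * Y ^ (-(1 - 1 / (2 * β))) * Y ^ (1 - 1 / (2 * β)) := (cap_scale_mul hY).symm
    _ ≤ η * Y ^ (-(1 - 1 / (2 * β))) * (1 + u) ^ (1 - 1 / (2 * β)) := by
      have : 0 ≤ 1 - 1 / (2 * β) := by linarith
      gcongr

theorem cappedRate_of_le (hβ : 1 < β) (hη : 0 < η) (hY : 0 < Y) {u : ℝ} (hu : 0 ≤ u)
    (h : 1 + u ≤ Y) : cappedRate β η (η * Y ^ (-(1 - 1 / (2 * β)))) u
      = η * Y ^ (-(1 - 1 / (2 * β))) * (1 + u) ^ (1 - 1 / (2 * β)) := by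
  have hβ' : 1 / (2 * β) ≤ 1 := by
    rw [div_le_one (by linarith)]; linarith
  rw [cappedRate, max_eq_left hu, min_eq_right]
  refine le_of_le_of_eq ?_ (cap_scale_mul (β := β) (η := η) hY)
  have : 0 ≤ 1 - 1 / (2 * β) := by linarith
  gcongr

theorem cappedPrice_of_ge (hβ : 1 < β) (hη : 0 < η) (hY : 0 < Y) {u : ℝ} (hu : 0 ≤ u)
    (h : Y ≤ 1 + u) : cappedPrice β η (η * Y ^ (-(1 - 1 / (2 * β)))) u
      = η * (1 + u) ^ (-(2 - 1 / β)) + η * Y ^ (-(2 - 1 / β)) := by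
  have hsq : (Y ^ (-(1 - 1 / (2 * β)))) ^ 2 = Y ^ (-(2 - 1 / β)) := by
    rw [← Real.rpow_natCast, ← Real.rpow_mul hY.le]
    congr 1
    push_cast
    field_simp
  rw [cappedPrice, cappedRate_of_ge hβ hη hY hu h, max_eq_left hu, forgettingKernel, mul_pow, hsq]
  field_simp

theorem cappedPrice_of_le (hβ : 1 < β) (hη : 0 < η) (hY : 0 < Y) {u : ℝ} (hu : 0 ≤ u)
    (h : 1 + u ≤ Y) : cappedPrice β η (η * Y ^ (-(1 - 1 / (2 * β)))) u
      = 2 * (η * Y ^ (-(1 - 1 / (2 * β)))) * (1 + u) ^ (-(1 - 1 / (2 * β))) := by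
  have hu1 : 0 < 1 + u := by linarith
  have hσ : 0 < η * Y ^ (-(1 - 1 / (2 * β))) := by positivity
  rw [cappedPrice, cappedRate_of_le hβ hη hY hu h, max_eq_left hu, forgettingKernel_eq_sq β hu]
  set σ := η * Y ^ (-(1 - 1 / (2 * β)))
  rw [Real.rpow_neg hu1.le]
  have : 0 < (1 + u) ^ (1 - 1 / (2 * β)) := by positivity
  field_simp
  norm_num

/-- Dividing by `a(y)` leaves a constant against a decreasing power of `1 + y`; the worst case `1 +
y = Y` is the threshold hypothesis. -/
theorem cappedPrice_lt_of_le (hβ : 1 < β) (hs : 0 < s) (hη : 0 < η) (hY : 0 < Y)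
    (hthr : 2 * η / s < Y ^ (1 - 1 / β - s)) {y : ℝ} (hy : 0 ≤ y) (h : 1 + y ≤ Y) :
    cappedPrice β η (η * Y ^ (-(1 - 1 / (2 * β)))) y < s * (1 + y) ^ (-s - 1) := by
  have hy1 : 0 < 1 + y := by linarith
  rw [cappedPrice_of_le hβ hη hY hy h, marginal_gain_eq β s hy]
  refine mul_lt_mul_of_pos_right ?_ (by positivity)
  have he : 0 < s + 1 / (2 * β) := by positivity
  rw [div_lt_iff₀ hs] at hthr
  calc 2 * (η * Y ^ (-(1 - 1 / (2 * β)))) = 2 * η * Y ^ (-(1 - 1 / (2 * β))) := by ring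
    _ < Y ^ (1 - 1 / β - s) * s * Y ^ (-(1 - 1 / (2 * β))) := by gcongr
    _ = s * Y ^ (-(s + 1 / (2 * β))) := by
      rw [mul_right_comm, ← Real.rpow_add hY, mul_comm]
      congr 2
      field_simp
      ring
    _ ≤ s * (1 + y) ^ (-(s + 1 / (2 * β))) := by
      refine mul_le_mul_of_nonneg_left ?_ hs.le
      exact Real.rpow_le_rpow_of_nonpos hy1 h (by linarith)

/-- The sign of the derivative is that of `η(2 - 1/β) - s(s+1) x^{1-1/β-s}`, negative because `s
x^{1-1/β-s} > 2η` from `Y` onwards. -/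
theorem strictAntiOn_net_gain (hβ : 1 < β) (hs : 0 < s) (hη : 0 < η) (hY : 0 < Y)
    (hκ : s < 1 - 1 / β) (hthr : 2 * η / s < Y ^ (1 - 1 / β - s)) :
    StrictAntiOn (fun x : ℝ => s * x ^ (-s - 1) - η * x ^ (-(2 - 1 / β))) (Ici Y) := by
  have hd : ∀ x : ℝ, 0 < x → HasDerivAt (fun x : ℝ => s * x ^ (-s - 1) - η * x ^ (-(2 - 1 / β)))
      (s * ((-s - 1) * x ^ (-s - 1 - 1)) - η * (-(2 - 1 / β) * x ^ (-(2 - 1 / β) - 1))) x :=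
    fun x hx => ((Real.hasDerivAt_rpow_const (Or.inl hx.ne')).const_mul s).sub
      ((Real.hasDerivAt_rpow_const (Or.inl hx.ne')).const_mul η)
  refine strictAntiOn_of_deriv_neg (convex_Ici Y)
    (fun x hx => (hd x (hY.trans_le hx)).continuousAt.continuousWithinAt) fun x hx => ?_
  rw [interior_Ici] at hx
  have hx0 : 0 < x := hY.trans hx
  have hβ0 : 0 < 1 / β := by positivity
  rw [(hd x hx0).deriv]
  have hx2 : x ^ (-s - 1 - 1) = x ^ (-(2 - 1 / β) - 1) * x ^ (1 - 1 / β - s) := by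
    rw [← Real.rpow_add hx0]
    congr 1
    ring
  have hthr' : 2 * η < s * x ^ (1 - 1 / β - s) := by
    rw [div_lt_iff₀ hs] at hthr
    have : Y ^ (1 - 1 / β - s) ≤ x ^ (1 - 1 / β - s) :=
      Real.rpow_le_rpow hY.le (le_of_lt hx) (by linarith)
    nlinarith
  have hA : 0 < x ^ (-(2 - 1 / β) - 1) := by positivity
  rw [hx2]
  have hB : 0 < x ^ (1 - 1 / β - s) := by positivity
  have key : η * (2 - 1 / β) - s * (s + 1) * x ^ (1 - 1 / β - s) < 0 := by
    have h1 : η * (2 - 1 / β) < 2 * η := by nlinarith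
    have h2 : 0 ≤ s * s * x ^ (1 - 1 / β - s) := by positivity
    nlinarith
  nlinarith [mul_neg_of_pos_of_neg hA key]

/-- Beyond `Y` the price is `η x^{-(2-1/β)}` plus a constant, so the comparison is between the
decreasing net gain and its value at `X`; below `Y` there is no crossing. -/
theorem cappedPrice_crossing {X : ℝ} (hβ : 1 < β) (hs : 0 < s) (hη : 0 < η) (hY : 0 < Y)
    (hκ : s < 1 - 1 / β) (hthr : 2 * η / s < Y ^ (1 - 1 / β - s)) (hYX : Y < X)
    (heq : s * X ^ (-s - 1) - η * X ^ (-(2 - 1 / β)) = η * Y ^ (-(2 - 1 / β))) {y : ℝ}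
    (hy : 0 ≤ y) :
    (1 + y < X → cappedPrice β η (η * Y ^ (-(1 - 1 / (2 * β)))) y < s * (1 + y) ^ (-s - 1)) ∧
      (X < 1 + y →
        s * (1 + y) ^ (-s - 1) < cappedPrice β η (η * Y ^ (-(1 - 1 / (2 * β)))) y) := by
  have hanti := strictAntiOn_net_gain hβ hs hη hY hκ hthr
  refine ⟨fun h => ?_, fun h => ?_⟩
  · rcases le_total (1 + y) Y with h' | h'
    · exact cappedPrice_lt_of_le hβ hs hη hY hthr hy h'
    · have := hanti h' hYX.le h
      simp only at this
      rw [cappedPrice_of_ge hβ hη hY hy h']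
      linarith
  · have hY' : Y ≤ 1 + y := (hYX.trans h).le
    have := hanti hYX.le hY' h
    simp only at this
    rw [cappedPrice_of_ge hβ hη hY hy hY']
    linarith

end ConstrainedPrice

/-! ### The stable–decay curve -/

section StableDecay

/-- Matching values and slopes give a genuine derivative at the junction, so the rate is also
correct at the switching time itself. -/
theorem hasDerivAt_ite_le {f g f' g' : ℝ → ℝ} {c z : ℝ} (hc : f c = g c) (hc' : f' c = g' c)
    (hf : z ≤ c → HasDerivAt f (f' z) z) (hg : c ≤ z → HasDerivAt g (g' z) z) :
    HasDerivAt (fun z => if z ≤ c then f z else g z) (if z ≤ c then f' z else g' z) z := by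
  rcases lt_trichotomy z c with h | rfl | h
  · rw [if_pos h.le]
    refine (hf h.le).congr_of_eventuallyEq ?_
    filter_upwards [Iio_mem_nhds h] with x hx
    exact if_pos (le_of_lt hx)
  · rw [if_pos le_rfl, ← hasDerivWithinAt_univ, ← Iic_union_Ici (a := z)]
    refine HasDerivWithinAt.union ?_ ?_
    · exact (hf le_rfl).hasDerivWithinAt.congr (fun x hx => if_pos hx) (if_pos le_rfl)
    · rw [hc']
      refine (hg le_rfl).hasDerivWithinAt.congr (fun x hx => ?_) (by rw [if_pos le_rfl, hc])
      rcases eq_or_lt_of_le (show z ≤ x from hx) with rfl | hlt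
      · rw [if_pos le_rfl, hc]
      · exact if_neg (not_le.2 hlt)
  · rw [if_neg (not_le.2 h)]
    refine (hg h.le).congr_of_eventuallyEq ?_
    filter_upwards [Ioi_mem_nhds h] with x hx
    exact if_neg (not_le.2 hx)

/-- Full learning rate `η` up to time `N₁`, then a linear decrease of
`(1 + t(N) - t(z))^{1/(2β)}` from `b` to `1`, with matching rates at `N₁`. -/
noncomputable def stableDecay (β η N₁ b z : ℝ) : ℝ :=
  if z ≤ N₁ then η * z
  else (η * N₁ + b ^ (2 * β)) - (b - η / (2 * β) * b ^ (-(2 * β - 1)) * (z - N₁)) ^ (2 * β)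

variable {β η N₁ N b : ℝ}

theorem stableDecay_base_mem (hβ : 1 < β) (hη : 0 < η) (hb : 1 < b)
    (hN : η * (N - N₁) = 2 * β * ((b - 1) * b ^ (2 * β - 1))) {z : ℝ} (hz1 : N₁ ≤ z) (hz : z ≤ N) :
    b - η / (2 * β) * b ^ (-(2 * β - 1)) * (z - N₁) ∈ Icc 1 b := by
  have hb0 : 0 < b := by linarith
  have hc : 0 ≤ η / (2 * β) * b ^ (-(2 * β - 1)) := by positivity
  have hN' : η / (2 * β) * b ^ (-(2 * β - 1)) * (N - N₁) = b - 1 := by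
    have h2 : b ^ (2 * β - 1) ≠ 0 := (Real.rpow_pos_of_pos hb0 _).ne'
    calc _ = b ^ (-(2 * β - 1)) / (2 * β) * (η * (N - N₁)) := by ring
      _ = b - 1 := by
        rw [hN, Real.rpow_neg hb0.le]
        field_simp
  have h1 : η / (2 * β) * b ^ (-(2 * β - 1)) * (z - N₁)
      ≤ η / (2 * β) * b ^ (-(2 * β - 1)) * (N - N₁) := by gcongr
  have h2 := mul_nonneg hc (by linarith : 0 ≤ z - N₁)
  constructor <;> linarith

/-- The base runs linearly from `b` to `1`; relative to `b` its final value is `1/b`, which is the ε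
of the schedule. -/
theorem stableDecay_base_eq (hβ : 1 < β) (hb : 1 < b) (hNN : N₁ < N)
    (hN : η * (N - N₁) = 2 * β * ((b - 1) * b ^ (2 * β - 1))) (z : ℝ) :
    b - η / (2 * β) * b ^ (-(2 * β - 1)) * (z - N₁)
      = b * (1 + 1 / b * ((z - N₁) / (N - N₁)) - (z - N₁) / (N - N₁)) := by
  have hb0 : 0 < b := by linarith
  have h2 : b ^ (2 * β - 1) ≠ 0 := (Real.rpow_pos_of_pos hb0 _).ne'
  have hD : N - N₁ ≠ 0 := by linarith
  have hη : η = 2 * β * ((b - 1) * b ^ (2 * β - 1)) / (N - N₁) := by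
    rw [← hN]
    field_simp
  rw [hη, Real.rpow_neg hb0.le]
  field_simp
  ring

theorem hasDerivAt_stableDecay (hβ : 1 < β) (hη : 0 < η) (hb : 1 < b)
    (hN : η * (N - N₁) = 2 * β * ((b - 1) * b ^ (2 * β - 1))) {z : ℝ} (hz : z ≤ N) :
    HasDerivAt (stableDecay β η N₁ b)
      (if z ≤ N₁ then η else η * b ^ (-(2 * β - 1))
        * (b - η / (2 * β) * b ^ (-(2 * β - 1)) * (z - N₁)) ^ (2 * β - 1)) z := by
  have hb0 : 0 < b := by linarith
  refine hasDerivAt_ite_le (f := fun z => η * z) (f' := fun _ => η)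
    (g' := fun z => η * b ^ (-(2 * β - 1))
        * (b - η / (2 * β) * b ^ (-(2 * β - 1)) * (z - N₁)) ^ (2 * β - 1)) (by simp) ?_ ?_ ?_
  · simp only [sub_self, mul_zero, sub_zero]
    rw [mul_assoc, ← Real.rpow_add hb0, neg_add_cancel, Real.rpow_zero, mul_one]
  · intro _
    simpa using (hasDerivAt_id z).const_mul η
  · intro hz1
    have := (stableDecay_base_mem hβ hη hb hN hz1 hz).1
    refine (hasDerivAt_sub_affine_rpow (β := β) (a := η * N₁ + b ^ (2 * β))
      (by linarith : 0 < b - η / (2 * β) * b ^ (-(2 * β - 1)) * (z - N₁))).congr_deriv ?_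
    field_simp

theorem stableDecay_terminal (hβ : 1 < β) (hb : 1 < b) (hNN : N₁ < N)
    (hN : η * (N - N₁) = 2 * β * ((b - 1) * b ^ (2 * β - 1))) :
    stableDecay β η N₁ b N = η * N₁ + b ^ (2 * β) - 1 := by
  have h1 : (N - N₁) / (N - N₁) = 1 := div_self (by linarith)
  have h2 : b * (1 + 1 / b * 1 - 1) = 1 := by
    field_simp
    ring
  rw [stableDecay, if_neg (not_le.2 hNN), stableDecay_base_eq hβ hb hNN hN, h1, h2, Real.one_rpow]

theorem isAdmissible_stableDecay (hβ : 1 < β) (hη : 0 < η) (hb : 1 < b) (hN₁ : 0 ≤ N₁)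
    (hNN : N₁ < N) (hN : η * (N - N₁) = 2 * β * ((b - 1) * b ^ (2 * β - 1))) :
    IsAdmissible η N (stableDecay β η N₁ b) := by
  have hb0 : 0 < b := by linarith
  refine isAdmissible_of_hasDerivWithinAt (hN₁.trans hNN.le) (by simp [stableDecay, hN₁])
    (fun z hz => (hasDerivAt_stableDecay hβ hη hb hN hz.2).hasDerivWithinAt) fun z hz => ?_
  split_ifs with h
  · exact ⟨hη.le, le_rfl⟩
  · have hw := stableDecay_base_mem hβ hη hb hN (not_le.1 h).le hz.2
    set w := b - η / (2 * β) * b ^ (-(2 * β - 1)) * (z - N₁)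
    have hw0 : 0 < w := by linarith [hw.1]
    refine ⟨by positivity, ?_⟩
    calc η * b ^ (-(2 * β - 1)) * w ^ (2 * β - 1)
        ≤ η * b ^ (-(2 * β - 1)) * b ^ (2 * β - 1) := by
          refine mul_le_mul_of_nonneg_left ?_ (by positivity)
          exact Real.rpow_le_rpow hw0.le hw.2 (by linarith)
      _ = η := by rw [mul_assoc, ← Real.rpow_add hb0, neg_add_cancel, Real.rpow_zero, mul_one]

theorem stableDecay_feedback (hβ : 1 < β) (hη : 0 < η) (hb : 1 < b) (hN₁ : 0 ≤ N₁)
    (hNN : N₁ < N) (hN : η * (N - N₁) = 2 * β * ((b - 1) * b ^ (2 * β - 1))) :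
    ∀ᵐ z ∂(volume.restrict (Icc 0 N)), deriv (stableDecay β η N₁ b) z =
      cappedRate β η (η * (b ^ (2 * β)) ^ (-(1 - 1 / (2 * β))))
        (stableDecay β η N₁ b N - stableDecay β η N₁ b z) := by
  have hb0 : 0 < b := by linarith
  have hY : 0 < b ^ (2 * β) := by positivity
  have hadm := isAdmissible_stableDecay hβ hη hb hN₁ hNN hN
  filter_upwards [ae_restrict_mem measurableSet_Icc] with z hz
  have hrem := (hadm.remaining_mem hz).1
  have hterm := stableDecay_terminal hβ hb hNN hN
  rw [(hasDerivAt_stableDecay hβ hη hb hN hz.2).deriv]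
  split_ifs with h
  · rw [cappedRate_of_ge hβ hη hY hrem]
    rw [hterm, stableDecay, if_pos h]
    have : η * z ≤ η * N₁ := by gcongr
    linarith
  · have hw := stableDecay_base_mem hβ hη hb hN (not_le.1 h).le hz.2
    have hone : 1 + (stableDecay β η N₁ b N - stableDecay β η N₁ b z)
        = (b - η / (2 * β) * b ^ (-(2 * β - 1)) * (z - N₁)) ^ (2 * β) := by
      rw [hterm, stableDecay, if_neg h]
      ring
    have hw0 : 0 < b - η / (2 * β) * b ^ (-(2 * β - 1)) * (z - N₁) := by linarith [hw.1]
    rw [cappedRate_of_le hβ hη hY hrem, hone, ← Real.rpow_mul hb0.le, ← Real.rpow_mul hw0.le]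
    · congr 3 <;> field_simp
    · rw [hone]
      exact Real.rpow_le_rpow hw0.le hw.2 (by linarith)

theorem IsOptimal.eqOn_stableDecay {s X : ℝ} {t : ℝ → ℝ} (hβ : 1 < β) (hs : 0 < s) (hη : 0 < η)
    (hκ : s < 1 - 1 / β) (hb : 1 < b) (hthr : 2 * η / s < (b ^ (2 * β)) ^ (1 - 1 / β - s))
    (hbX : b ^ (2 * β) < X)
    (heq : s * X ^ (-s - 1) - η * X ^ (-(2 - 1 / β)) = η * (b ^ (2 * β)) ^ (-(2 - 1 / β)))
    (hN₁ : η * N₁ = X - b ^ (2 * β)) (hNN : N₁ < N)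
    (hN : η * (N - N₁) = 2 * β * ((b - 1) * b ^ (2 * β - 1))) (ht : IsOptimal β s η N t) :
    EqOn t (stableDecay β η N₁ b) (Icc 0 N) := by
  have hb0 : 0 < b := by linarith
  have hY : 0 < b ^ (2 * β) := by positivity
  have hN₁0 : 0 ≤ N₁ := by
    refine le_of_mul_le_mul_left ?_ hη
    rw [mul_zero, hN₁]
    linarith
  have hσ : 0 < η * (b ^ (2 * β)) ^ (-(1 - 1 / (2 * β))) := by positivity
  have hadm := isAdmissible_stableDecay hβ hη hb hN₁0 hNN hN
  have hterm : 1 + stableDecay β η N₁ b N = X := by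
    rw [stableDecay_terminal hβ hb hNN hN, hN₁]
    ring
  have hN0 : 0 ≤ N := hN₁0.trans hNN.le
  refine IsOptimal.eqOn_of_certificate hN0 (continuous_cappedPrice hσ hη) hadm
    (lam := (η * (b ^ (2 * β)) ^ (-(1 - 1 / (2 * β)))) ^ 2) (monotoneOn_cappedRate hβ hσ _)
    (stableDecay_feedback hβ hη hb hN₁0 hNN hN)
    (fun u hu => cappedPrice_mul_cappedRate hσ hη hu) ?_ ?_
    (fun u hu v hv => (cappedPrice_mul_le hσ hη hu hv.2).1)
    (fun u hu v hv => (cappedPrice_mul_le hσ hη hu hv.2).2) ht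
  · exact fun y hy => (cappedPrice_crossing hβ hs hη hY hκ hthr hbX heq hy.1).1
      (by linarith [hy.2])
  · exact fun y hy => (cappedPrice_crossing hβ hs hη hY hκ hthr hbX heq
      ((hadm.terminal_nonneg hN0).trans hy.le)).2 (by linarith)

end StableDecay

/-! ### Hard task: switching level, horizon and asymptotics -/

section HardTask

variable {β s η : ℝ}

/-- The remaining intrinsic time (plus one) at which the decay phase starts, as a function of the
terminal intrinsic time (plus one). -/
noncomputable def switchLevel (β s η X : ℝ) : ℝ :=
  (X ^ (s + 1) / (s / η - X ^ (-(1 - 1 / β - s)))) ^ (1 / (2 - 1 / β))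

/-- The crossing equation reads `Y^{-(2-1/β)} = X^{-s-1}(s/η - X^{-(1-1/β-s)})`. The threshold keeps
the bracket between `s/(2η)` and `s/η`, which gives two-sided power bounds, and `Y < X` because the
exponents `s + 1` and `1 - 1/β - s` add up to `2 - 1/β`. -/
theorem switchLevel_spec (hβ : 1 < β) (hs : 0 < s) (hη : 0 < η) (hκ : s < 1 - 1 / β) {X : ℝ}
    (hX : 0 < X) (hthr : 2 * η / s < X ^ (1 - 1 / β - s)) :
    0 < s / η - X ^ (-(1 - 1 / β - s)) ∧
      (η / s) ^ (1 / (2 - 1 / β)) * X ^ ((s + 1) / (2 - 1 / β)) ≤ switchLevel β s η X ∧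
      switchLevel β s η X ≤ (2 * η / s) ^ (1 / (2 - 1 / β)) * X ^ ((s + 1) / (2 - 1 / β)) ∧
      switchLevel β s η X < X ∧
      s * X ^ (-s - 1) - η * X ^ (-(2 - 1 / β)) = η * (switchLevel β s η X) ^ (-(2 - 1 / β)) := by
  have hβ1 : 1 / β < 1 := by rw [div_lt_one (by linarith)]; exact hβ
  have hp : 0 < 2 - 1 / β := by linarith
  have hXκ : 0 < X ^ (1 - 1 / β - s) := by positivity
  have hinv : X ^ (-(1 - 1 / β - s)) ≤ s / (2 * η) := by
    rw [Real.rpow_neg hX.le, inv_le_comm₀ hXκ (by positivity), inv_div]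
    exact hthr.le
  have hhalf : s / (2 * η) = s / η / 2 := by field_simp
  have hsη : 0 < s / η := by positivity
  have hinv0 : 0 < X ^ (-(1 - 1 / β - s)) := by positivity
  have hlo : s / (2 * η) ≤ s / η - X ^ (-(1 - 1 / β - s)) := by linarith
  have hA : 0 < s / η - X ^ (-(1 - 1 / β - s)) := lt_of_lt_of_le (by positivity) hlo
  have hroot : ∀ c : ℝ, 0 < c → (c * X ^ (s + 1)) ^ (1 / (2 - 1 / β))
      = c ^ (1 / (2 - 1 / β)) * X ^ ((s + 1) / (2 - 1 / β)) := fun c hc => by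
    rw [Real.mul_rpow hc.le (by positivity), ← Real.rpow_mul hX.le]
    congr 2
    ring
  have hexp : 0 < 1 / (2 - 1 / β) := by positivity
  have hup : X ^ (s + 1) / (s / η - X ^ (-(1 - 1 / β - s))) ≤ 2 * η / s * X ^ (s + 1) := by
    rw [div_le_iff₀ hA]
    calc X ^ (s + 1) = 2 * η / s * X ^ (s + 1) * (s / (2 * η)) := by field_simp
      _ ≤ _ := by gcongr
  refine ⟨hA, ?_, ?_, ?_, ?_⟩
  · rw [← hroot _ (by positivity)]
    refine Real.rpow_le_rpow (by positivity) ?_ hexp.le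
    rw [le_div_iff₀ hA]
    calc η / s * X ^ (s + 1) * (s / η - X ^ (-(1 - 1 / β - s)))
        ≤ η / s * X ^ (s + 1) * (s / η) := by
          gcongr
          linarith
      _ = X ^ (s + 1) := by field_simp
  · rw [← hroot _ (by positivity)]
    exact Real.rpow_le_rpow (by positivity) hup hexp.le
  · have hlt : X ^ (s + 1) / (s / η - X ^ (-(1 - 1 / β - s))) < X ^ (2 - 1 / β) := by
      refine lt_of_le_of_lt hup ?_
      calc 2 * η / s * X ^ (s + 1) < X ^ (1 - 1 / β - s) * X ^ (s + 1) := by gcongr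
        _ = X ^ (2 - 1 / β) := by
          rw [← Real.rpow_add hX]
          congr 1
          ring
    have := Real.rpow_lt_rpow (by positivity) hlt hexp
    rwa [← Real.rpow_mul hX.le, mul_one_div_cancel hp.ne', Real.rpow_one] at this
  · have hYp : switchLevel β s η X ^ (-(2 - 1 / β))
        = (s / η - X ^ (-(1 - 1 / β - s))) * X ^ (-s - 1) := by
      rw [switchLevel, ← Real.rpow_mul (by positivity),
        show 1 / (2 - 1 / β) * -(2 - 1 / β) = -1 by
          rw [mul_neg, one_div_mul_cancel hp.ne'], Real.rpow_neg_one, inv_div,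
        show -s - 1 = -(s + 1) by ring, Real.rpow_neg hX.le (s + 1), div_eq_mul_inv]
    rw [hYp, sub_mul, ← Real.rpow_add hX, mul_sub]
    congr 1
    · field_simp
    · congr 2
      ring

theorem continuousOn_switchLevel {X₀ : ℝ} (hX₀ : 0 < X₀)
    (h : ∀ X, X₀ ≤ X → 0 < s / η - X ^ (-(1 - 1 / β - s))) :
    ContinuousOn (switchLevel β s η) (Ici X₀) := by
  have hne : ∀ X ∈ Ici X₀, X ≠ 0 := fun X hX => (hX₀.trans_le hX).ne'
  refine ContinuousOn.rpow_const (ContinuousOn.div ?_ (continuousOn_const.sub ?_) ?_) ?_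
  · exact continuousOn_id.rpow_const fun X hX => Or.inl (hne X hX)
  · exact continuousOn_id.rpow_const fun X hX => Or.inl (hne X hX)
  · exact fun X hX => (h X hX).ne'
  · exact fun X hX => Or.inl
      (div_pos (Real.rpow_pos_of_pos (hX₀.trans_le hX) _) (h X hX)).ne'

/-- The first bound feeds `switchLevel_spec`, the second makes `b ≥ 2` so that `b - 1` is comparable
to `b`, and the third is the single-crossing condition at `Y`. -/
theorem exists_switchLevel_threshold (hβ : 1 < β) (hs : 0 < s) (hη : 0 < η)
    (hκ : s < 1 - 1 / β) :
    ∃ X₀ : ℝ, 1 ≤ X₀ ∧ ∀ X, X₀ ≤ X → 2 * η / s < X ^ (1 - 1 / β - s) ∧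
      (2 : ℝ) ^ (2 * β) ≤ switchLevel β s η X ∧
      2 * η / s < switchLevel β s η X ^ (1 - 1 / β - s) := by
  have hβ1 : 1 / β < 1 := by rw [div_lt_one (by linarith)]; exact hβ
  have hp : 0 < 2 - 1 / β := by linarith
  have hκ0 : 0 < 1 - 1 / β - s := by linarith
  have hthr : ∀ᶠ X : ℝ in atTop, 2 * η / s < X ^ (1 - 1 / β - s) :=
    (tendsto_rpow_atTop hκ0).eventually_gt_atTop _
  have hlim : Tendsto (switchLevel β s η) atTop atTop := by
    have h1 : Tendsto (fun X : ℝ => (η / s) ^ (1 / (2 - 1 / β)) * X ^ ((s + 1) / (2 - 1 / β)))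
        atTop atTop := (tendsto_rpow_atTop (by positivity)).const_mul_atTop (by positivity)
    refine tendsto_atTop_mono' _ ?_ h1
    filter_upwards [hthr, eventually_gt_atTop 0] with X hX hX0
    exact (switchLevel_spec hβ hs hη hκ hX0 hX).2.1
  obtain ⟨X₀, hX₀⟩ := eventually_atTop.1 ((hthr.and (hlim.eventually_ge_atTop (2 ^ (2 * β)))).and
    (((tendsto_rpow_atTop hκ0).comp hlim).eventually_gt_atTop (2 * η / s)))
  refine ⟨max X₀ 1, le_max_right _ _, fun X hX => ?_⟩
  have := hX₀ X ((le_max_left _ _).trans hX)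
  exact ⟨this.1.1, this.1.2, this.2⟩

/-- The length of the decay phase. -/
noncomputable def decayTime (β η b : ℝ) : ℝ := 2 * β * ((b - 1) * b ^ (2 * β - 1)) / η

theorem decayTime_bounds (hβ : 1 < β) (hη : 0 < η) {b : ℝ} (hb : 2 ≤ b) :
    β * b ^ (2 * β) / η ≤ decayTime β η b ∧ decayTime β η b ≤ 2 * β * b ^ (2 * β) / η := by
  have hb0 : 0 < b := by linarith
  have hpow : b ^ (2 * β) = b * b ^ (2 * β - 1) := by
    rw [Real.rpow_sub_one hb0.ne']
    field_simp
  have hpos : 0 < b ^ (2 * β - 1) := by positivity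
  unfold decayTime
  rw [hpow]
  constructor
  · gcongr ?_ / η
    have : 0 < β * b ^ (2 * β - 1) := by positivity
    nlinarith
  · gcongr
    linarith

/-- The horizon for which the stable–decay schedule with terminal level `X` is optimal. -/
noncomputable def hardHorizon (β s η X : ℝ) : ℝ :=
  (X - switchLevel β s η X) / η + decayTime β η (switchLevel β s η X ^ (1 / (2 * β)))

theorem switchLevel_root (hβ : 1 < β) {Y : ℝ} (hY : (2 : ℝ) ^ (2 * β) ≤ Y) :
    2 ≤ Y ^ (1 / (2 * β)) ∧ (Y ^ (1 / (2 * β))) ^ (2 * β) = Y := by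
  have h2 : (0 : ℝ) < 2 ^ (2 * β) := by positivity
  constructor
  · have := Real.rpow_le_rpow h2.le hY (by positivity : 0 ≤ 1 / (2 * β))
    rwa [← Real.rpow_mul zero_le_two, mul_one_div_cancel (by positivity), Real.rpow_one] at this
  · rw [← Real.rpow_mul (h2.trans_le hY).le, one_div_mul_cancel (by positivity), Real.rpow_one]

theorem hardHorizon_bounds (hβ : 1 < β) (hη : 0 < η) {X : ℝ}
    (hY : (2 : ℝ) ^ (2 * β) ≤ switchLevel β s η X) (hYX : switchLevel β s η X < X) :
    X ≤ η * hardHorizon β s η X ∧ η * hardHorizon β s η X ≤ (1 + 2 * β) * X := by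
  obtain ⟨hb, hbY⟩ := switchLevel_root hβ hY
  obtain ⟨h1, h2⟩ := decayTime_bounds hβ hη hb
  rw [hbY, div_le_iff₀ hη] at h1
  rw [hbY, le_div_iff₀ hη] at h2
  have hY0 : 0 < switchLevel β s η X := lt_of_lt_of_le (by positivity) hY
  have h3 : η * hardHorizon β s η X = X - switchLevel β s η X
      + decayTime β η (switchLevel β s η X ^ (1 / (2 * β))) * η := by
    rw [hardHorizon]
    field_simp
  rw [h3]
  constructor <;> nlinarith

theorem eventually_exists_hardHorizon_eq (hβ : 1 < β) (hs : 0 < s) (hη : 0 < η)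
    (hκ : s < 1 - 1 / β) {X₀ : ℝ} (hX₀ : 1 ≤ X₀)
    (h : ∀ X, X₀ ≤ X → 2 * η / s < X ^ (1 - 1 / β - s) ∧ (2 : ℝ) ^ (2 * β) ≤ switchLevel β s η X) :
    ∀ᶠ N : ℝ in atTop, ∃ X, X₀ ≤ X ∧ hardHorizon β s η X = N := by
  have hspec : ∀ X, X₀ ≤ X → _ := fun X hX =>
    switchLevel_spec hβ hs hη hκ (by linarith : 0 < X) (h X hX).1
  have hY := continuousOn_switchLevel (β := β) (s := s) (η := η) (by linarith : 0 < X₀)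
    fun X hX => (hspec X hX).1
  have hpos : ∀ X, X₀ ≤ X → 0 < switchLevel β s η X := fun X hX =>
    lt_of_lt_of_le (by positivity) (h X hX).2
  have hcont : ContinuousOn (hardHorizon β s η) (Ici X₀) := by
    have hroot : ContinuousOn (fun X => switchLevel β s η X ^ (1 / (2 * β))) (Ici X₀) :=
      hY.rpow_const fun X hX => Or.inl (hpos X hX).ne'
    have hroot' : ContinuousOn (fun X => (switchLevel β s η X ^ (1 / (2 * β))) ^ (2 * β - 1))
        (Ici X₀) :=
      hroot.rpow_const fun X hX => Or.inl (Real.rpow_pos_of_pos (hpos X hX) _).ne'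
    refine ((continuousOn_id.sub hY).div_const η).add ?_
    exact (continuousOn_const.mul ((hroot.sub continuousOn_const).mul hroot')).div_const η
  filter_upwards [eventually_ge_atTop (hardHorizon β s η X₀)] with N hN
  -- The horizon is at least `X/η`, so `X ≥ ηN` overshoots `N`.
  have hle : X₀ ≤ max X₀ (η * N) := le_max_left _ _
  have hup : N ≤ hardHorizon β s η (max X₀ (η * N)) := by
    have h1 := (hardHorizon_bounds hβ hη (h _ hle).2 (hspec _ hle).2.2.2.1).1
    exact le_of_mul_le_mul_left ((le_max_right _ _).trans h1) hη
  obtain ⟨X, hX, hXN⟩ := intermediate_value_Icc hle (hcont.mono Icc_subset_Ici_self) ⟨hN, hup⟩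
  exact ⟨X, hX.1, hXN⟩

theorem IsAdmissible.terminal_loss_le {N : ℝ} {t : ℝ → ℝ} (ht : IsAdmissible η N t) (hN : 0 ≤ N) :
    (1 + t N) ^ (-s) ≤ finalLoss β s N t := by
  refine le_add_of_nonneg_right (intervalIntegral.integral_nonneg hN fun z hz => ?_)
  exact mul_nonneg (forgettingKernel_nonneg β (ht.remaining_mem hz).1) (sq_nonneg _)

theorem hardTask (hβ : 1 < β) (hs : 0 < s) (hη : 0 < η) (hκ : s < 1 - 1 / β) :
    ∃ c C : ℝ, 0 < c ∧ 0 < C ∧ ∃ ρ : ℝ → ℝ, Tendsto ρ atTop (𝓝 0) ∧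
      ∀ᶠ N : ℝ in atTop, ∀ t : ℝ → ℝ, IsOptimal β s η N t →
        (c * N ^ (-s) ≤ finalLoss β s N t ∧ finalLoss β s N t ≤ C * N ^ (-s)) ∧
        ∃ N₁ ε : ℝ, 0 < N₁ ∧ N₁ < N ∧ |ε| ≤ ρ N ∧
          c * N ^ (-(((1 - 1 / β) - s) / (2 - 1 / β))) ≤ (N - N₁) / N ∧
          (N - N₁) / N ≤ C * N ^ (-(((1 - 1 / β) - s) / (2 - 1 / β))) ∧
          (N - N₁) / N ≤ ρ N ∧
          (∀ z ∈ Icc 0 N₁, HasDerivWithinAt t η (Icc 0 N) z) ∧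
          ∀ z ∈ Ioc N₁ N,
            0 ≤ 1 + ε * ((z - N₁) / (N - N₁)) - (z - N₁) / (N - N₁) ∧
            HasDerivWithinAt t
              (η * (1 + ε * ((z - N₁) / (N - N₁)) - (z - N₁) / (N - N₁)) ^ (2 * β - 1))
              (Icc 0 N) z := by
  have hβ1 : 1 / β < 1 := by rw [div_lt_one (by linarith)]; exact hβ
  have hp : 0 < 2 - 1 / β := by linarith
  obtain ⟨X₀, hX₀, hthr⟩ := exists_switchLevel_threshold hβ hs hη hκ
  obtain ⟨C₁, hC₁, hub⟩ := eventually_finalLoss_le (s := s) (θ := 1) hβ hη one_pos le_rfl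
    (by linarith)
  set e : ℝ := (s + 1) / (2 - 1 / β) with he
  have he0 : 0 < e := by positivity
  have he1 : -((1 - 1 / β - s) / (2 - 1 / β)) = e - 1 := by
    rw [he, div_sub_one hp.ne', ← neg_div]
    ring
  have he1' : 0 < (1 - 1 / β - s) / (2 - 1 / β) := div_pos (by linarith) hp
  -- These constants turn the bounds on `Y` in terms of `X` into bounds in terms of `N`, through
  -- `ηN/(1+2β) ≤ X ≤ ηN`.
  set a₁ : ℝ := (η / s) ^ (1 / (2 - 1 / β)) * (η / (1 + 2 * β)) ^ e with ha₁
  set a₂ : ℝ := (2 * η / s) ^ (1 / (2 - 1 / β)) * η ^ e with ha₂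
  have ha₁0 : 0 < a₁ := by positivity
  have ha₂0 : 0 < a₂ := by positivity
  -- In ρ the first entry of the maximum bounds the decay fraction, the second bounds `ε = 1/b =
  -- Y^{-1/(2β)}`.
  refine ⟨min ((2 * η) ^ (-s)) (β / η * a₁), max C₁ (2 * β / η * a₂),
    lt_min (by positivity) (by positivity), lt_max_of_lt_left hC₁,
    fun N => max (2 * β / η * a₂ * N ^ (-((1 - 1 / β - s) / (2 - 1 / β))))
      ((a₁ * N ^ e) ^ (-(1 / (2 * β)))), ?_, ?_⟩
  · have h1 := (tendsto_rpow_neg_atTop he1').const_mul (2 * β / η * a₂)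
    have h2 : Tendsto (fun N : ℝ => (a₁ * N ^ e) ^ (-(1 / (2 * β)))) atTop (𝓝 0) :=
      (tendsto_rpow_neg_atTop (by positivity)).comp
        ((tendsto_rpow_atTop he0).const_mul_atTop ha₁0)
    rw [mul_zero] at h1
    simpa using h1.max h2
  filter_upwards [eventually_exists_hardHorizon_eq hβ hs hη hκ hX₀
    fun X hX => ⟨(hthr X hX).1, (hthr X hX).2.1⟩, hub, eventually_gt_atTop 0,
    eventually_ge_atTop (1 / η)] with N hexists hubN hN0 hNη t ht
  have hNs : 0 ≤ N ^ (-s) := by positivity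
  refine ⟨⟨?_, ?_⟩, ?_⟩
  · refine le_trans ?_ (ht.1.terminal_loss_le hN0.le)
    have hT := ht.1.terminal_le hN0.le
    have hT0 := ht.1.terminal_nonneg hN0.le
    rw [div_le_iff₀ hη] at hNη
    calc _ ≤ (2 * η) ^ (-s) * N ^ (-s) := by
          gcongr
          exact min_le_left _ _
      _ = (2 * η * N) ^ (-s) := (Real.mul_rpow (by positivity) hN0.le).symm
      _ ≤ (1 + t N) ^ (-s) :=
          Real.rpow_le_rpow_of_nonpos (by linarith) (by linarith) (by linarith)
  · have := hubN t ht
    rw [one_mul] at this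
    refine this.trans ?_
    gcongr
    exact le_max_left _ _
  obtain ⟨X, hX, hXN⟩ := hexists
  obtain ⟨h1, h2, h3⟩ := hthr X hX
  have hX0 : 0 < X := by linarith
  obtain ⟨-, hYlo, hYup, hYX, heq⟩ := switchLevel_spec hβ hs hη hκ hX0 h1
  obtain ⟨hNlo, hNup⟩ := hardHorizon_bounds hβ hη h2 hYX
  obtain ⟨hb, hbY⟩ := switchLevel_root hβ h2
  obtain ⟨hDlo, hDup⟩ := decayTime_bounds hβ hη hb
  rw [hXN] at hNlo hNup
  rw [hbY] at hDlo hDup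
  have hNdef : N = (X - switchLevel β s η X) / η
      + decayTime β η (switchLevel β s η X ^ (1 / (2 * β))) := hXN.symm
  have hY0 : 0 < switchLevel β s η X := lt_of_lt_of_le (by positivity) h2
  have hbinv : 1 / switchLevel β s η X ^ (1 / (2 * β))
      = switchLevel β s η X ^ (-(1 / (2 * β))) := by
    rw [Real.rpow_neg hY0.le, one_div]
  have hYlo' : a₁ * N ^ e ≤ switchLevel β s η X := by
    refine le_trans ?_ hYlo
    rw [ha₁, mul_assoc, ← Real.mul_rpow (by positivity) hN0.le]
    gcongr
    rw [div_mul_eq_mul_div, div_le_iff₀ (by positivity)]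
    linarith
  have hYup' : switchLevel β s η X ≤ a₂ * N ^ e := by
    refine hYup.trans ?_
    rw [ha₂, mul_assoc, ← Real.mul_rpow hη.le hN0.le]
    gcongr
  set Y := switchLevel β s η X
  set b := Y ^ (1 / (2 * β))
  set D := decayTime β η b with hD
  have hb0 : 0 < b := by linarith
  have hD0 : 0 < D := lt_of_lt_of_le (by positivity) hDlo
  have hN₁0 : 0 < (X - Y) / η := div_pos (by linarith) hη
  have hNN : N - (X - Y) / η = D := by linarith
  have hDη : η * (N - (X - Y) / η) = 2 * β * ((b - 1) * b ^ (2 * β - 1)) := by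
    rw [hNN, hD, decayTime]
    field_simp
  have hNN₁ : (X - Y) / η < N := by linarith
  rw [← hbY] at h3 heq hYX
  have hON := ht.eqOn_stableDecay hβ hs hη hκ (by linarith) h3 hYX heq
    (by rw [hbY]; field_simp) hNN₁ hDη
  have hrate : N ^ (-((1 - 1 / β - s) / (2 - 1 / β))) = N ^ e / N := by
    rw [he1, Real.rpow_sub_one hN0.ne']
  have hDN : D / N ≤ 2 * β / η * a₂ * N ^ (-((1 - 1 / β - s) / (2 - 1 / β))) := by
    rw [hrate, ← mul_div_assoc]
    gcongr
    calc D ≤ 2 * β * Y / η := hDup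
      _ ≤ 2 * β * (a₂ * N ^ e) / η := by gcongr
      _ = 2 * β / η * a₂ * N ^ e := by ring
  have hrate0 : 0 ≤ N ^ (-((1 - 1 / β - s) / (2 - 1 / β))) := by positivity
  refine ⟨(X - Y) / η, 1 / b, hN₁0, hNN₁, ?_, ?_, ?_, ?_, ?_, ?_⟩
  · rw [abs_of_pos (by positivity), hbinv]
    refine le_trans ?_ (le_max_right _ _)
    refine Real.rpow_le_rpow_of_nonpos (by positivity) hYlo' ?_
    rw [neg_nonpos]
    positivity
  · rw [hNN]
    calc _ ≤ β / η * a₁ * N ^ (-((1 - 1 / β - s) / (2 - 1 / β))) := by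
          gcongr
          exact min_le_right _ _
      _ = β * (a₁ * N ^ e) / η / N := by
          rw [hrate]
          ring
      _ ≤ β * Y / η / N := by gcongr
      _ ≤ D / N := by gcongr
  · rw [hNN]
    refine hDN.trans ?_
    gcongr
    exact le_max_right _ _
  · rw [hNN]
    exact hDN.trans (le_max_left _ _)
  · intro z hz
    have hzN : z ∈ Icc 0 N := ⟨hz.1, hz.2.trans hNN₁.le⟩
    have hd := hasDerivAt_stableDecay hβ hη (by linarith : 1 < b) hDη hzN.2
    rw [if_pos hz.2] at hd
    exact hd.hasDerivWithinAt.congr hON (hON hzN)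
  · intro z hz
    have hzN : z ∈ Icc 0 N := ⟨hN₁0.le.trans hz.1.le, hz.2⟩
    have hd := hasDerivAt_stableDecay hβ hη (by linarith : 1 < b) hDη hzN.2
    have hw := stableDecay_base_mem hβ hη (by linarith : 1 < b) hDη hz.1.le hz.2
    rw [if_neg (not_le.2 hz.1)] at hd
    rw [stableDecay_base_eq hβ (by linarith) hNN₁ hDη] at hd hw
    have hpos : 0 ≤ 1 + 1 / b * ((z - (X - Y) / η) / (N - (X - Y) / η))
        - (z - (X - Y) / η) / (N - (X - Y) / η) := by
      by_contra hneg
      have := mul_neg_of_pos_of_neg hb0 (not_le.1 hneg)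
      linarith [hw.1]
    refine ⟨hpos, (hd.hasDerivWithinAt.congr hON (hON hzN)).congr_deriv ?_⟩
    rw [Real.mul_rpow hb0.le hpos, Real.rpow_neg hb0.le]
    have : b ^ (2 * β - 1) ≠ 0 := (Real.rpow_pos_of_pos hb0 _).ne'
    field_simp

end HardTask

theorem theorem1 (β s ηstab : ℝ) (hβ : 1 < β) (hs : 0 < s) (hη : 0 < ηstab) :
    -- easy-task regime: the rate of the optimal loss
    (1 - 1 / β ≤ s →
      ∃ c C : ℝ, 0 < c ∧ 0 < C ∧
        ∀ᶠ N : ℝ in atTop, ∀ t : ℝ → ℝ, IsOptimal β s ηstab N t →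
          c * N ^ (-(s * β / (s * β + 1))) ≤ finalLoss β s N t ∧
          finalLoss β s N t ≤ C * N ^ (-(s * β / (s * β + 1)))) ∧
    -- easy-task regime: the optimal schedule is a power decay
    (1 - 1 / β < s ∨ (s = 1 - 1 / β ∧ (1 - 1 / β) / 2 ≤ ηstab) →
      ∃ c C : ℝ, 0 < c ∧ 0 < C ∧ ∃ ρ : ℝ → ℝ, Tendsto ρ atTop (𝓝 0) ∧
        ∀ᶠ N : ℝ in atTop, ∀ t : ℝ → ℝ, IsOptimal β s ηstab N t →
          ∃ ηpeak δ : ℝ, |δ| ≤ ρ N ∧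
            c * N ^ (-((1 + s * β - β) / (1 + s * β))) ≤ ηpeak ∧
            ηpeak ≤ C * N ^ (-((1 + s * β - β) / (1 + s * β))) ∧
            ∀ z ∈ Icc 0 N, 0 ≤ 1 + δ - z / N ∧
              HasDerivWithinAt t (ηpeak * (1 + δ - z / N) ^ (2 * β - 1)) (Icc 0 N) z) ∧
    -- hard-task regime: stable phase followed by a power decay
    (s < 1 - 1 / β →
      ∃ c C : ℝ, 0 < c ∧ 0 < C ∧ ∃ ρ : ℝ → ℝ, Tendsto ρ atTop (𝓝 0) ∧
        ∀ᶠ N : ℝ in atTop, ∀ t : ℝ → ℝ, IsOptimal β s ηstab N t →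
          (c * N ^ (-s) ≤ finalLoss β s N t ∧ finalLoss β s N t ≤ C * N ^ (-s)) ∧
          ∃ N₁ ε : ℝ, 0 < N₁ ∧ N₁ < N ∧ |ε| ≤ ρ N ∧
            c * N ^ (-(((1 - 1 / β) - s) / (2 - 1 / β))) ≤ (N - N₁) / N ∧
            (N - N₁) / N ≤ C * N ^ (-(((1 - 1 / β) - s) / (2 - 1 / β))) ∧
            (N - N₁) / N ≤ ρ N ∧
            (∀ z ∈ Icc 0 N₁, HasDerivWithinAt t ηstab (Icc 0 N) z) ∧
            ∀ z ∈ Ioc N₁ N,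
              0 ≤ 1 + ε * ((z - N₁) / (N - N₁)) - (z - N₁) / (N - N₁) ∧
              HasDerivWithinAt t
                (ηstab * (1 + ε * ((z - N₁) / (N - N₁)) - (z - N₁) / (N - N₁)) ^ (2 * β - 1))
                (Icc 0 N) z) := by
  exact ⟨easyTask_rate hβ hs hη, easyTask_schedule hβ hs hη, hardTask hβ hs hη⟩
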